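/- Let $\mathbb{D}$ be the open unit disk in $\mathbb{C}$, and let $H^2$ be the Hardy space of all analytic functions $f$ on $\mathbb{D}$ with $$\|f\|^2=\lim_{r\to1^-}\frac1{2\pi}\int_0^{2\pi}|f(re^{i\theta})|^2\,d\theta<\infty .$$ Let $\varphi:\mathbb{D}\to\mathbb{D}$ be analytic and let $n\ge 1$ be an integer. Let $D_{\varphi,n}$ be given by the rule $D_{\varphi,n}(f)=f^{(n)}\circ\varphi$ for $f\in H^2$. Let $N_\varphi$ be the Nevanlinna counting function of $\varphi$: for $w\in\mathbb{D}\setminus\{\varphi(0)\}$, $$N_\varphi(w)=\sum_{\varphi(z)=w}\log\frac1{|z|},$$ the sum being over the points $z\in\mathbb{D}$ with $\varphi(z)=w$, counted with multiplicity, and $N_\varphi(\varphi(0))=\infty$. Then $D_{\varphi,n}$ is a compact operator on $H^2$ (that is, it defines a bounded linear operator from $H^2$ into $H^2$, and this operator is compact) if and only if $$N_\varphi(w)=o\Big(\Big[\log\frac1{|w|}\Big]^{2n+1}\Big)\qquad(|w|\to1),$$ that is, for every $\varepsilon>0$ there is $R\in(0,1)$ such that $N_\varphi(w)\le\varepsilon\,[\log(1/|w|)]^{2n+1}$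 whenever $R<|w|<1$. -/

import Mathlib

open Filter Topology Metric

/-- The integral mean `(1/2π) ∫₀^{2π} |f(r e^{iθ})|² dθ`. -/
noncomputable def hardyMean (f : ℂ → ℂ) (r : ℝ) : ℝ :=
  Real.circleAverage (fun z => ‖f z‖ ^ 2) 0 r

theorem integral_exp_int_mul (m : ℤ) :
    (∫ x in (0 : ℝ)..(2 * Real.pi), Complex.exp (m * Complex.I * x))
      = if m = 0 then (2 * Real.pi : ℂ) else 0 := by
  split_ifs with h
  · subst h; simp
  · have hc : (m : ℂ) * Complex.I ≠ 0 := by simp [h]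
    rw [integral_exp_mul_complex hc]
    have : Complex.exp ((m : ℂ) * Complex.I * ((2 * Real.pi : ℝ) : ℂ)) = 1 := by
      rw [← Complex.exp_int_mul_two_pi_mul_I m]; congr 1; push_cast; ring
    rw [this]; simp

theorem continuousOn_circle {f : ℂ → ℂ} (hf : ContinuousOn f (ball 0 1)) {r : ℝ}
    (hr : r ∈ Set.Ico (0 : ℝ) 1) : Continuous fun x : ℝ => f (circleMap 0 r x) := by
  refine hf.comp_continuous (continuous_circleMap 0 r) fun x => ?_
  simp [abs_of_nonneg hr.1, hr.2]

theorem fourierCoeffOn_circle {f : ℂ → ℂ} (hf : DifferentiableOn ℂ f (ball 0 1)) {r : ℝ}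
    (hr : r ∈ Set.Ico (0 : ℝ) 1) (k : ℤ) :
    fourierCoeffOn Real.two_pi_pos (fun x : ℝ => f (circleMap 0 r x)) k =
      if 0 ≤ k then ((k.toNat.factorial : ℂ)⁻¹ * iteratedDeriv k.toNat f 0) * (r : ℂ) ^ k.toNat
        else 0 := by
  set b : ℕ → ℂ := fun n => (n.factorial : ℂ)⁻¹ * iteratedDeriv n f 0 with hb
  have hsum : ∀ z ∈ ball (0 : ℂ) 1, HasSum (fun n => b n * z ^ n) (f z) := by
    intro z hz
    convert! Complex.hasSum_taylorSeries_on_ball hf hz using 2 with n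
    simp [hb]; ring
  have hnorm : Summable fun n => ‖b n * (r : ℂ) ^ n‖ :=
    (hsum r (by simp [abs_of_nonneg hr.1, hr.2])).summable.norm
  let g : ℕ → C(ℝ, ℂ) := fun n =>
    ⟨fun x => (b n * (r : ℂ) ^ n) * Complex.exp (((n : ℤ) - k : ℤ) * Complex.I * x),
      by fun_prop⟩
  have hg : Summable fun n : ℕ =>
      ‖(g n).restrict (⟨Set.uIcc 0 (2 * Real.pi), isCompact_uIcc⟩ : TopologicalSpace.Compacts ℝ)‖ := by
    refine Summable.of_nonneg_of_le (fun _ => norm_nonneg _) (fun n => ?_) hnorm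
    rw [ContinuousMap.norm_le _ (norm_nonneg _)]
    intro x
    have : ‖Complex.exp (((n : ℤ) - k : ℤ) * Complex.I * ((x : ℝ) : ℂ))‖ = 1 := by
      rw [Complex.norm_exp]; simp
    change ‖(b n * (r : ℂ) ^ n) * Complex.exp (((n : ℤ) - k : ℤ) * Complex.I * ((x : ℝ) : ℂ))‖ ≤ _
    rw [norm_mul, this, mul_one]
  have key := intervalIntegral.hasSum_intervalIntegral_of_summable_norm hg
  have hpt : ∀ x : ℝ, (fourier (-k) (x : AddCircle (2 * Real.pi - 0)) : ℂ) • f (circleMap 0 r x)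
      = ∑' n, g n x := by
    intro x
    have h1 := (hsum (circleMap 0 r x) (by simp [abs_of_nonneg hr.1, hr.2])).mul_left
      (fourier (-k) (x : AddCircle (2 * Real.pi - 0)) : ℂ)
    rw [smul_eq_mul, ← h1.tsum_eq]
    refine tsum_congr fun n => ?_
    simp only [g, ContinuousMap.coe_mk, fourier_coe_apply, circleMap, zero_add]
    rw [mul_pow, ← Complex.exp_nat_mul]
    have : Complex.exp (((n : ℤ) - k : ℤ) * Complex.I * x)
        = Complex.exp (2 * Real.pi * Complex.I * ((-k : ℤ) : ℂ) * x / ((2 * Real.pi - 0 : ℝ) : ℂ))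
          * Complex.exp (n * (x * Complex.I)) := by
      rw [← Complex.exp_add]; congr 1; push_cast
      have := Complex.ofReal_ne_zero.2 Real.pi_ne_zero
      rw [sub_zero]; field_simp; ring
    rw [this]; ring
  rw [fourierCoeffOn_eq_integral, intervalIntegral.integral_congr (fun x _ => hpt x),
    ← key.tsum_eq]
  have hterm : ∀ n : ℕ, (∫ x in (0 : ℝ)..(2 * Real.pi), g n x)
      = if (n : ℤ) = k then b n * (r : ℂ) ^ n * (2 * Real.pi) else 0 := by
    intro n
    simp only [g, ContinuousMap.coe_mk]
    rw [intervalIntegral.integral_const_mul, integral_exp_int_mul]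
    simp [sub_eq_zero]
  simp_rw [hterm]
  have hpi := Complex.ofReal_ne_zero.2 Real.pi_ne_zero
  split_ifs with hk
  · lift k to ℕ using hk
    rw [tsum_eq_single k (by intro n hn; simp [hn])]
    simp only [if_true, Int.toNat_natCast, hb, Complex.real_smul]
    push_cast; rw [sub_zero]; field_simp
  · have : ∀ n : ℕ, (n : ℤ) ≠ k := by intro n; omega
    simp [this]

/-- Parseval's identity on the circle of radius `r`. -/
theorem hasSum_hardyMean {f : ℂ → ℂ} (hf : DifferentiableOn ℂ f (ball 0 1)) {r : ℝ}
    (hr : r ∈ Set.Ico (0 : ℝ) 1) :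
    HasSum (fun n : ℕ => ‖(n.factorial : ℂ)⁻¹ * iteratedDeriv n f 0‖ ^ 2 * r ^ (2 * n))
      (hardyMean f r) := by
  have hc := continuousOn_circle hf.continuousOn hr
  have hL : MeasureTheory.MemLp (fun x : ℝ => f (circleMap 0 r x)) 2
      (MeasureTheory.volume.restrict (Set.Ioc 0 (2 * Real.pi))) :=
    (MeasureTheory.memLp_two_iff_integrable_sq_norm hc.aestronglyMeasurable).2
      (hc.norm.pow 2).integrableOn_Ioc
  have h := hasSum_sq_fourierCoeffOn Real.two_pi_pos hL
  rw [sub_zero] at h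
  have h' := (Nat.cast_injective (R := ℤ)).hasSum_iff (f := fun i : ℤ =>
    ‖fourierCoeffOn Real.two_pi_pos (fun x : ℝ => f (circleMap 0 r x)) i‖ ^ 2)
    (a := hardyMean f r) (by
      intro k hk
      have : ¬ 0 ≤ k := fun h0 => hk ⟨k.toNat, by simp [h0]⟩
      simp [fourierCoeffOn_circle hf hr, this])
  convert! h'.2 h using 2 with n
  rw [Function.comp, fourierCoeffOn_circle hf hr, if_pos (by positivity), Int.toNat_natCast,
    norm_mul _ ((r : ℂ) ^ n), mul_pow, norm_pow (r : ℂ), Complex.norm_real,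
    Real.norm_of_nonneg hr.1, ← pow_mul, mul_comm n 2]

theorem hardyMean_nonneg (f : ℂ → ℂ) (r : ℝ) : 0 ≤ hardyMean f r :=
  Real.circleAverage_nonneg_of_nonneg fun _ _ => by positivity

theorem hardyMean_monotoneOn {f : ℂ → ℂ} (hf : DifferentiableOn ℂ f (ball 0 1)) :
    MonotoneOn (hardyMean f) (Set.Ico 0 1) := fun r hr s hs hrs =>
  hasSum_le (fun n => by have := hr.1; gcongr) (hasSum_hardyMean hf hr) (hasSum_hardyMean hf hs)

theorem hardyMean_le_of_tendsto {f : ℂ → ℂ} (hf : DifferentiableOn ℂ f (ball 0 1)) {L : ℝ}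
    (hL : Tendsto (hardyMean f) (𝓝[<] 1) (𝓝 L)) {r : ℝ} (hr : r ∈ Set.Ico (0 : ℝ) 1) :
    hardyMean f r ≤ L := by
  refine ge_of_tendsto hL ?_
  filter_upwards [Ico_mem_nhdsLT hr.2] with s hs
  exact hardyMean_monotoneOn hf hr ⟨hr.1.trans hs.1, hs.2⟩ hs.1

theorem exists_tendsto_hardyMean {f : ℂ → ℂ} (hf : DifferentiableOn ℂ f (ball 0 1)) {C : ℝ}
    (hC : ∀ r ∈ Set.Ico (0 : ℝ) 1, hardyMean f r ≤ C) :
    ∃ L, Tendsto (hardyMean f) (𝓝[<] 1) (𝓝 L) :=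
  ⟨_, ((hardyMean_monotoneOn hf).mono Set.Ioo_subset_Ico_self).tendsto_nhdsWithin_Ioo_left
    (by norm_num) ⟨C, by rintro _ ⟨r, hr, rfl⟩; exact hC r ⟨hr.1.le, hr.2⟩⟩⟩

theorem hardyMean_add_le {f g : ℂ → ℂ} (hf : DifferentiableOn ℂ f (ball 0 1))
    (hg : DifferentiableOn ℂ g (ball 0 1)) {r t : ℝ} (hr : r ∈ Set.Ico (0 : ℝ) 1) (ht : 0 < t) :
    hardyMean (f + g) r ≤ (1 + t) * hardyMean f r + (1 + t⁻¹) * hardyMean g r := by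
  have hcf := continuousOn_circle hf.continuousOn hr
  have hcg := continuousOn_circle hg.continuousOn hr
  have hi : ∀ u : ℂ → ℝ, Continuous (fun x : ℝ => u (circleMap 0 r x)) →
      CircleIntegrable u 0 r := fun u hu => hu.intervalIntegrable _ _
  have hF : Continuous fun x : ℝ => ‖f (circleMap 0 r x)‖ ^ 2 := hcf.norm.pow 2
  have hG : Continuous fun x : ℝ => ‖g (circleMap 0 r x)‖ ^ 2 := hcg.norm.pow 2
  have e : (1 + t) * hardyMean f r + (1 + t⁻¹) * hardyMean g r =
      Real.circleAverage (fun z => (1 + t) * ‖f z‖ ^ 2 + (1 + t⁻¹) * ‖g z‖ ^ 2) 0 r := by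
    unfold hardyMean Real.circleAverage
    rw [intervalIntegral.integral_add, intervalIntegral.integral_const_mul,
      intervalIntegral.integral_const_mul]
    · simp only [smul_eq_mul]; ring
    · exact (hF.const_mul _).intervalIntegrable _ _
    · exact (hG.const_mul _).intervalIntegrable _ _
  rw [e]
  refine Real.circleAverage_mono (hi _ (((hcf.add hcg).norm).pow 2)) (hi _ ((hF.const_mul _).add (hG.const_mul _))) ?_
  intro z _
  have h1 : ‖(f + g) z‖ ^ 2 ≤ (‖f z‖ + ‖g z‖) ^ 2 := by
    gcongr; exact norm_add_le _ _
  have h2 : (1 + t) * ‖f z‖ ^ 2 + (1 + t⁻¹) * ‖g z‖ ^ 2 - (‖f z‖ + ‖g z‖) ^ 2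
      = t⁻¹ * (t * ‖f z‖ - ‖g z‖) ^ 2 := by field_simp; ring
  have h3 : 0 ≤ t⁻¹ * (t * ‖f z‖ - ‖g z‖) ^ 2 := by positivity
  linarith

theorem hardyMean_smul (c : ℂ) (f : ℂ → ℂ) (r : ℝ) :
    hardyMean (c • f) r = ‖c‖ ^ 2 * hardyMean f r := by
  unfold hardyMean Real.circleAverage
  simp only [Pi.smul_apply, smul_eq_mul, norm_mul, mul_pow, intervalIntegral.integral_const_mul]
  ring

/-- The vector space of analytic functions `f` on the open unit disk for which
`lim_{r → 1⁻} (1/2π) ∫₀^{2π} |f(r e^{iθ})|² dθ` exists and is finite. A function on the disk is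
represented by its extension by zero to `ℂ`, so equality of elements is equality on the disk. -/
noncomputable def hardySubmodule : Submodule ℂ (ℂ → ℂ) where
  carrier := {f | DifferentiableOn ℂ f (ball 0 1) ∧ (∀ z ∉ ball (0 : ℂ) 1, f z = 0) ∧
    ∃ L : ℝ, Tendsto (hardyMean f) (𝓝[<] 1) (𝓝 L)}
  zero_mem' := ⟨differentiableOn_const 0, fun _ _ => rfl, 0, by
    have : hardyMean 0 = fun _ => 0 := by
      funext r; simpa using hardyMean_smul 0 0 r
    rw [this]; exact tendsto_const_nhds⟩
  add_mem' := by
    rintro f g ⟨hf, hf0, A, hA⟩ ⟨hg, hg0, B, hB⟩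
    refine ⟨hf.add hg, fun z hz => by simp [hf0 z hz, hg0 z hz],
      exists_tendsto_hardyMean (hf.add hg) (C := 2 * A + 2 * B) fun r hr => ?_⟩
    have h := hardyMean_add_le hf hg hr one_pos
    have h1 := hardyMean_le_of_tendsto hf hA hr
    have h2 := hardyMean_le_of_tendsto hg hB hr
    norm_num at h
    linarith
  smul_mem' := by
    rintro c f ⟨hf, hf0, A, hA⟩
    refine ⟨hf.const_smul c, fun z hz => by simp [hf0 z hz], ‖c‖ ^ 2 * A, ?_⟩
    exact (hA.const_mul (‖c‖ ^ 2)).congr fun r => (hardyMean_smul c f r).symm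

/-- The Hardy space `H²` of the unit disk. -/
def HardySpace : Type := hardySubmodule

namespace HardySpace

noncomputable instance : AddCommGroup HardySpace := inferInstanceAs (AddCommGroup hardySubmodule)

noncomputable instance : Module ℂ HardySpace := inferInstanceAs (Module ℂ hardySubmodule)

instance : CoeFun HardySpace fun _ => ℂ → ℂ := ⟨fun f => Subtype.val (p := (· ∈ hardySubmodule)) f⟩

/-- `‖f‖² = lim_{r → 1⁻} (1/2π) ∫₀^{2π} |f(r e^{iθ})|² dθ`. -/
noncomputable instance : Norm HardySpace := ⟨fun f => √(limUnder (𝓝[<] (1 : ℝ)) (hardyMean f))⟩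

theorem differentiableOn (f : HardySpace) : DifferentiableOn ℂ f (ball 0 1) := f.2.1

theorem tendsto_hardyMean (f : HardySpace) :
    Tendsto (hardyMean f) (𝓝[<] 1) (𝓝 (‖f‖ ^ 2)) := by
  obtain ⟨L, hL⟩ := f.2.2.2
  have h0 : 0 ≤ L := ge_of_tendsto' hL (hardyMean_nonneg _)
  have : ‖f‖ ^ 2 = L := by
    change √(limUnder (𝓝[<] (1 : ℝ)) (hardyMean f)) ^ 2 = L
    rw [hL.limUnder_eq, Real.sq_sqrt h0]
  rwa [this]

theorem norm_nonneg' (f : HardySpace) : 0 ≤ ‖f‖ := Real.sqrt_nonneg _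

theorem eq_zero_of_norm {f : HardySpace} (h : ‖f‖ = 0) : f = 0 := by
  refine Subtype.ext (funext fun z => ?_)
  by_cases hz : z ∈ ball (0 : ℂ) 1
  · have ht := tendsto_hardyMean f
    have hr : (1 / 2 : ℝ) ∈ Set.Ico (0 : ℝ) 1 := by norm_num
    have h1 := hardyMean_le_of_tendsto f.differentiableOn ht hr
    have h2 := hasSum_hardyMean f.differentiableOn hr
    have h3 : hardyMean f (1 / 2) = 0 :=
      le_antisymm (by simpa [h] using h1) (hardyMean_nonneg _ _)
    rw [h3, hasSum_zero_iff_of_nonneg (fun n => by positivity)] at h2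
    have hb : ∀ n, iteratedDeriv n f 0 = 0 := by
      intro n
      have := congrFun h2 n
      simpa [Nat.factorial_ne_zero] using this
    have h4 := Complex.hasSum_taylorSeries_on_ball f.differentiableOn hz
    simp only [hb, smul_zero] at h4
    exact h4.unique hasSum_zero
  · exact f.2.2.1 z hz

theorem normedSpaceCore : NormedSpace.Core ℂ HardySpace where
  norm_nonneg := norm_nonneg'
  norm_smul c f := by
    have h1 := tendsto_hardyMean (c • f)
    have h2 := (tendsto_hardyMean f).const_mul (‖c‖ ^ 2)
    have h3 : ‖c • f‖ ^ 2 = (‖c‖ * ‖f‖) ^ 2 := by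
      rw [mul_pow]
      refine tendsto_nhds_unique h1 (h2.congr fun r => ?_)
      exact (hardyMean_smul c f r).symm
    exact (pow_left_inj₀ (norm_nonneg' _) (mul_nonneg (norm_nonneg _) (norm_nonneg' _))
      two_ne_zero).1 h3
  norm_triangle f g := by
    have key : ∀ t : ℝ, 0 < t → ‖f + g‖ ^ 2 ≤ (1 + t) * ‖f‖ ^ 2 + (1 + t⁻¹) * ‖g‖ ^ 2 := by
      intro t ht
      refine le_of_tendsto_of_tendsto (tendsto_hardyMean (f + g))
        (((tendsto_hardyMean f).const_mul (1 + t)).add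
          ((tendsto_hardyMean g).const_mul (1 + t⁻¹))) ?_
      filter_upwards [Ico_mem_nhdsLT (zero_lt_one' ℝ)] with r hr
      exact hardyMean_add_le f.differentiableOn g.differentiableOn hr ht
    rcases (norm_nonneg' f).eq_or_lt with hf | hf
    · rw [← hf, eq_zero_of_norm hf.symm, zero_add, zero_add]
    rcases (norm_nonneg' g).eq_or_lt with hg | hg
    · rw [← hg, eq_zero_of_norm hg.symm, add_zero, add_zero]
    refine (sq_le_sq₀ (norm_nonneg' _) (by positivity)).1 ?_
    refine (key (‖g‖ / ‖f‖) (by positivity)).trans_eq ?_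
    field_simp; ring
  norm_eq_zero_iff f := by
    refine ⟨eq_zero_of_norm, ?_⟩
    rintro rfl
    have h1 := tendsto_hardyMean 0
    have h2 : hardyMean (0 : HardySpace) = fun _ => 0 := by
      funext r
      change hardyMean (0 : ℂ → ℂ) r = 0
      simpa using hardyMean_smul 0 0 r
    rw [h2] at h1
    exact pow_eq_zero_iff two_ne_zero |>.1 (tendsto_nhds_unique h1 tendsto_const_nhds)

noncomputable instance : NormedAddCommGroup HardySpace := NormedAddCommGroup.ofCore normedSpaceCore

noncomputable instance : NormedSpace ℂ HardySpace := NormedSpace.ofCore normedSpaceCore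

end HardySpace

/-- `D_{φ,n}` is a compact operator on `H²`: the rule `f ↦ f⁽ⁿ⁾ ∘ φ` (on the unit disk) defines a
bounded linear operator of `H²` into itself, and this operator is compact. -/
def IsCompactCompDeriv (φ : ℂ → ℂ) (n : ℕ) : Prop :=
  ∃ T : HardySpace →L[ℂ] HardySpace,
    (∀ f : HardySpace, ∀ z ∈ ball (0 : ℂ) 1, T f z = iteratedDeriv n f (φ z)) ∧
      IsCompactOperator T

open Classical in
/-- The Nevanlinna counting function `N_φ(w) = ∑_{φ(z) = w} log (1/|z|)`, the sum being over the
points `z` of the unit disk with `φ(z) = w`, each repeated according to its multiplicity as a zero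
of `φ - w`, and `N_φ(φ(0)) = ∞`. -/
noncomputable def nevanlinnaCounting (φ : ℂ → ℂ) (w : ℂ) : ENNReal :=
  if w = φ 0 then ⊤
  else ∑' z : {z : ℂ // z ∈ ball (0 : ℂ) 1 ∧ φ z = w},
    (analyticOrderNatAt (fun ζ => φ ζ - w) z : ENNReal) * ENNReal.ofReal (Real.log (1 / ‖(z : ℂ)‖))

/-! The central quantity is J(u, c, r, v), here `jensenDefect u c r v`, read in two ways. By
Jensen's formula it is the sum of log(r/|z - c|) over the zeros of u - v in the disk, with
multiplicity (`exists_finset_jensenDefect_eq`); for u = φ and c = 0 this is N_φ(v) truncated to the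
disk of radius r. As a difference of logarithmic averages it can be integrated over v by Tonelli and
the explicit logarithmic potential of a disk, with value (π/2)(mean of |u|² - |u(c)|²)
(`lintegral_jensenDefect`). This is a Littlewood–Paley identity obtained without area integrals of
|u'|².

Necessity. A compact operator sends the normalized Szegő kernels √(1 - |a|²) k_a to functions
tending to 0 in norm as |a| → 1 (`tendsto_compDeriv_szegoKernel`). Put h = k_a⁽ⁿ⁾ and g = h ∘ φ.
Points with φ(z) = a are zeros of g - h(a), so N_φ(a) is at most the supremum over r of J(g, 0, r,
h(a)). Expanding the logarithm to second order bounds J(g, 0, r, v) by a multiple of ‖g‖²/|v|² when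
|v| ≥ 2‖g‖ (`jensenDefect_le`); no sub-mean-value property of N_φ is needed. Since |h(a)| is
comparable to (1 - |a|²)^(-(n+1)) and ‖g‖² = o(1/(1 - |a|²)), the exponent 2n + 1 appears.

Sufficiency. Put h = f⁽ⁿ⁾. Grouping the zeros of h ∘ φ - v by their image gives J(h ∘ φ, 0, r, v) as
a sum of truncated N_φ(w) over solutions of h(w) = v. Near the unit circle N_φ(w) ≤ ε
log(1/|w|)^(2n+1). Elsewhere the universal bound log(2/|w - φ(0)|) is absorbed by J of h on two
fixed compact disks (`ofReal_jensenDefect_comp_le`). The power of the logarithm is a superposition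
over s of the kernels (log(1/|w|) - s)⁺, which are Jensen kernels for the radius e^(-s). Integrating
over v and using Parseval on each circle bounds that part by εK‖f‖². The remaining part is
controlled by sup |f⁽ⁿ⁾|² on a compact set, which is small relative to ‖f‖² when f has a zero of
high order at 0. Hence the operator is bounded and is the norm limit of its compositions with Taylor
truncations, which are compact. -/

/-- The difference between the two sides of Jensen's inequality for `u - v` on the circle of centre
`c` and radius `r`. -/
noncomputable def jensenDefect (u : ℂ → ℂ) (c : ℂ) (r : ℝ) (v : ℂ) : ℝ :=
  Real.circleAverage (fun z => Real.log ‖u z - v‖) c r - Real.log ‖u c - v‖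

/-! ### Jensen's formula as a counting function -/

section Jensen

variable {u : ℂ → ℂ} {c : ℂ} {r : ℝ} {v : ℂ}

theorem analyticOrderAt_sub_ne_top (hu : AnalyticOnNhd ℂ u (closedBall c r)) (hr : 0 < r)
    (hv : v ≠ u c) {z : ℂ} (hz : z ∈ closedBall c r) :
    analyticOrderAt (fun ζ => u ζ - v) z ≠ ⊤ := by
  have ha : AnalyticOnNhd ℂ (fun ζ => u ζ - v) (closedBall c r) := hu.sub analyticOnNhd_const
  refine ha.analyticOrderAt_ne_top_of_isPreconnected (convex_closedBall c r).isPreconnected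
    (x := c) (by simp [hr.le]) hz ?_
  rw [(ha c (by simp [hr.le])).analyticOrderAt_eq_zero.2 (sub_ne_zero.2 hv.symm)]
  simp

theorem analyticOrderNatAt_sub_eq_zero (hu : AnalyticOnNhd ℂ u (closedBall c r))
    {z : ℂ} (hz : z ∈ closedBall c r) (h : u z ≠ v) :
    analyticOrderNatAt (fun ζ => u ζ - v) z = 0 := by
  have ha : AnalyticOnNhd ℂ (fun ζ => u ζ - v) (closedBall c r) := hu.sub analyticOnNhd_const
  rw [analyticOrderNatAt, (ha z hz).analyticOrderAt_eq_zero.2 (sub_ne_zero.2 h)]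
  simp

/-- Jensen's formula for `u - v`, as a finite sum. -/
theorem exists_finset_jensenDefect_eq (hu : AnalyticOnNhd ℂ u (closedBall c r)) (hr : 0 < r)
    (hv : v ≠ u c) : ∃ S : Finset ℂ, (∀ z ∈ S, z ∈ ball c r ∧ u z = v) ∧
      (∀ z ∈ ball c r, u z = v → z ∈ S) ∧
      jensenDefect u c r v =
        ∑ z ∈ S, (analyticOrderNatAt (fun ζ => u ζ - v) z : ℝ) * Real.log (r / ‖z - c‖) := by
  have ha : AnalyticOnNhd ℂ (fun ζ => u ζ - v) (closedBall c r) := hu.sub analyticOnNhd_const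
  have ha' : AnalyticOnNhd ℂ (fun ζ => u ζ - v) (closedBall c |r|) := by rwa [abs_of_pos hr]
  have hJ := ha'.circleAverage_log_norm hr.ne' (sub_ne_zero.2 hv.symm)
  rw [abs_of_pos hr] at hJ
  set D := MeromorphicOn.divisor (fun ζ => u ζ - v) (closedBall c r) with hD
  have hfin : D.support.Finite := D.finiteSupport (isCompact_closedBall c r)
  have hDa : ∀ z ∈ closedBall c r, D z = (analyticOrderNatAt (fun ζ => u ζ - v) z : ℤ) :=
    fun z hz => by
      rw [hD, MeromorphicOn.AnalyticOnNhd.divisor_apply ha hz, analyticOrderNatAt]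
      cases analyticOrderAt (fun ζ => u ζ - v) z <;> rfl
  have hsub : ∀ z, D z ≠ 0 → z ∈ closedBall c r ∧ u z = v := by
    intro z hz
    have h1 := D.supportWithinDomain hz
    refine ⟨h1, ?_⟩
    by_contra h
    rw [hDa z h1, analyticOrderNatAt_sub_eq_zero hu h1 h] at hz
    exact hz rfl
  classical
  -- The divisor lives on the closed disk; zeros on the boundary circle may be discarded because
  -- their weight is log 1 = 0.
  refine ⟨hfin.toFinset.filter (· ∈ ball c r), ?_, ?_, ?_⟩
  · intro z hz
    rw [Finset.mem_filter, Set.Finite.mem_toFinset] at hz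
    exact ⟨hz.2, (hsub z hz.1).2⟩
  · intro z hz hzv
    rw [Finset.mem_filter, Set.Finite.mem_toFinset]
    refine ⟨?_, hz⟩
    rw [Function.mem_support, hDa z (ball_subset_closedBall hz)]
    have h1 := analyticOrderAt_sub_ne_top hu hr hv (ball_subset_closedBall hz)
    have h2 : analyticOrderAt (fun ζ => u ζ - v) z ≠ 0 := by
      rw [Ne, (ha z (ball_subset_closedBall hz)).analyticOrderAt_eq_zero]
      simp [hzv]
    simp only [analyticOrderNatAt, Ne, Nat.cast_eq_zero, ENat.toNat_eq_zero, not_or]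
    exact ⟨h2, h1⟩
  · rw [jensenDefect, hJ, add_sub_cancel_right, finsum_eq_sum_of_support_subset (s := hfin.toFinset)]
    · rw [Finset.sum_filter]
      refine Finset.sum_congr rfl fun z hz => ?_
      obtain ⟨h1, h2⟩ := hsub z (hfin.mem_toFinset.1 hz)
      rw [hDa z h1, norm_sub_rev, ← div_eq_mul_inv]
      split_ifs with h
      · norm_cast
      · have : ‖z - c‖ = r := by
          rw [mem_closedBall, dist_eq_norm] at h1
          rw [mem_ball, dist_eq_norm] at h
          linarith
        rw [this, div_self hr.ne']; simp
    · intro z hz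
      simp only [Set.Finite.coe_toFinset, Function.mem_support]
      intro h
      simp [h] at hz

/-- All terms of Jensen's sum are nonnegative, so any part of it is a lower bound. Points of `W`
outside the fibre over `v` are harmless: the order there is 0, which forces `m` to vanish. -/
theorem sum_mul_log_le_jensenDefect (hu : AnalyticOnNhd ℂ u (closedBall c r)) (hr : 0 < r)
    (hv : v ≠ u c) (W : Finset ℂ) (m : ℂ → ℕ) (hW : ∀ z ∈ W, z ∈ ball c r)
    (hm : ∀ z ∈ W, m z ≤ analyticOrderNatAt (fun ζ => u ζ - v) z) :
    ∑ z ∈ W, (m z : ℝ) * Real.log (r / ‖z - c‖) ≤ jensenDefect u c r v := by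
  classical
  obtain ⟨S, hS1, hS2, hS⟩ := exists_finset_jensenDefect_eq hu hr hv
  have hlog : ∀ z ∈ ball c r, 0 ≤ Real.log (r / ‖z - c‖) := by
    intro z hz
    rcases eq_or_ne z c with rfl | h
    · simp
    · rw [mem_ball, dist_eq_norm] at hz
      exact Real.log_nonneg ((one_le_div (norm_pos_iff.2 (sub_ne_zero.2 h))).2 hz.le)
  rw [hS]
  calc ∑ z ∈ W, (m z : ℝ) * Real.log (r / ‖z - c‖)
      ≤ ∑ z ∈ W, (analyticOrderNatAt (fun ζ => u ζ - v) z : ℝ) * Real.log (r / ‖z - c‖) := by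
        refine Finset.sum_le_sum fun z hz => ?_
        exact mul_le_mul_of_nonneg_right (by exact_mod_cast hm z hz) (hlog z (hW z hz))
    _ = ∑ z ∈ W.filter (· ∈ S),
          (analyticOrderNatAt (fun ζ => u ζ - v) z : ℝ) * Real.log (r / ‖z - c‖) := by
        rw [Finset.sum_filter]
        refine Finset.sum_congr rfl fun z hz => ?_
        split_ifs with h
        · rfl
        · rw [analyticOrderNatAt_sub_eq_zero hu (ball_subset_closedBall (hW z hz))
            (fun h' => h (hS2 z (hW z hz) h'))]
          simp
    _ ≤ _ := by
        refine Finset.sum_le_sum_of_subset_of_nonneg (fun z hz => (Finset.mem_filter.1 hz).2) ?_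
        intro z hz _
        exact mul_nonneg (Nat.cast_nonneg _) (hlog z (hS1 z hz).1)

theorem jensenDefect_nonneg (hu : AnalyticOnNhd ℂ u (closedBall c r)) (hr : 0 < r)
    (hv : v ≠ u c) : 0 ≤ jensenDefect u c r v := by
  simpa using sum_mul_log_le_jensenDefect hu hr hv ∅ 0 (by simp) (by simp)

theorem jensenDefect_eq_zero (hu : AnalyticOnNhd ℂ u (closedBall c r)) (hr : 0 < r)
    (hv : ∀ z ∈ closedBall c r, u z ≠ v) : jensenDefect u c r v = 0 := by
  obtain ⟨S, hS1, -, hS⟩ := exists_finset_jensenDefect_eq hu hr (hv c (by simp [hr.le])).symm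
  rw [hS]
  refine Finset.sum_eq_zero fun z hz => ?_
  exact absurd (hS1 z hz).2 (hv z (ball_subset_closedBall (hS1 z hz).1))

theorem circleIntegrable_log_norm_sub (hu : AnalyticOnNhd ℂ u (closedBall c r)) (hr : 0 < r)
    (v : ℂ) : CircleIntegrable (fun z => Real.log ‖u z - v‖) c r := by
  refine MeromorphicOn.circleIntegrable_log_norm (f := fun z => u z - v) fun z hz => ?_
  have hz' : z ∈ closedBall c r := sphere_subset_closedBall (by rwa [abs_of_pos hr] at hz)
  exact ((hu z hz').sub analyticAt_const).meromorphicAt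

end Jensen

/-! ### The logarithmic potential of a disk -/

open MeasureTheory

/-- This is the radial integrand of the potential in polar coordinates, with a = |x|. For a = 0 the
logarithm is unbounded and continuity rests on that of s log s. -/
theorem continuous_mul_log_sub_log_max {a : ℝ} (ha : 0 ≤ a) (M : ℝ) :
    Continuous fun s : ℝ => s * (Real.log (2 * M) - Real.log (max s a)) := by
  rcases ha.eq_or_lt with rfl | ha'
  · have h : (fun s : ℝ => s * (Real.log (2 * M) - Real.log (max s 0))) =
        fun s => s * Real.log (2 * M) - max s 0 * Real.log (max s 0) := by
      funext s
      rcases le_total s 0 with h | h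
      · simp [max_eq_right h]
      · rw [max_eq_left h]; ring
    rw [h]
    have := Real.continuous_mul_log.comp (continuous_id.max (continuous_const (y := (0 : ℝ))))
    exact (continuous_id.mul continuous_const).sub this
  · have : ∀ s : ℝ, max s a ≠ 0 := fun s => (ha'.trans_le (le_max_right _ _)).ne'
    fun_prop (disch := exact this _)

theorem integral_mul_log_sub_log_max {M a : ℝ} (ha : 0 ≤ a) (haM : a ≤ M) (hM : 0 < M) :
    ∫ s in (0 : ℝ)..M, s * (Real.log (2 * M) - Real.log (max s a)) =
      (M ^ 2 * (Real.log 2 + 1 / 2) - a ^ 2 / 2) / 2 := by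
  have hi : ∀ x y : ℝ, IntervalIntegrable
      (fun s : ℝ => s * (Real.log (2 * M) - Real.log (max s a))) volume x y :=
    fun x y => (continuous_mul_log_sub_log_max ha M).intervalIntegrable x y
  have h1 : ∫ s in (0 : ℝ)..a, s * (Real.log (2 * M) - Real.log (max s a)) =
      a ^ 2 / 2 * (Real.log (2 * M) - Real.log a) := by
    rw [intervalIntegral.integral_congr (g := fun s => s * (Real.log (2 * M) - Real.log a)),
      intervalIntegral.integral_mul_const, integral_id]
    · ring
    · intro s hs
      rw [Set.uIcc_of_le ha] at hs
      simp only [max_eq_right hs.2]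
  have h2 : ∫ s in a..M, s * (Real.log (2 * M) - Real.log (max s a)) =
      (M ^ 2 / 2 * (Real.log (2 * M) - Real.log M) + M ^ 2 / 4) -
      (a ^ 2 / 2 * (Real.log (2 * M) - Real.log a) + a ^ 2 / 4) := by
    refine intervalIntegral.integral_eq_sub_of_hasDerivAt_of_le haM (f := fun s =>
      s ^ 2 / 2 * (Real.log (2 * M) - Real.log s) + s ^ 2 / 4) ?_ ?_ (hi _ _)
    · have h : (fun s : ℝ => s ^ 2 / 2 * (Real.log (2 * M) - Real.log s) + s ^ 2 / 4) =
          fun s => s ^ 2 / 2 * Real.log (2 * M) - s / 2 * (s * Real.log s) + s ^ 2 / 4 := by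
        funext s; ring
      rw [h]
      have := Real.continuous_mul_log
      fun_prop
    · intro s hs
      have hs0 : 0 < s := ha.trans_lt hs.1
      rw [max_eq_left hs.1.le]
      have := ((((hasDerivAt_id s).pow 2).div_const 2).mul
        ((Real.hasDerivAt_log hs0.ne').const_sub (Real.log (2 * M)))).add
        (((hasDerivAt_id s).pow 2).div_const 4)
      refine this.congr_deriv ?_
      simp only [id, Pi.pow_apply]
      field_simp
      ring
  rw [← intervalIntegral.integral_add_adjacent_intervals (hi 0 a) (hi a M), h1, h2,
    Real.log_mul two_ne_zero hM.ne']
  ring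

theorem circleAverage_log_norm_sub_eq_log_max {s : ℝ} (hs : 0 < s) (x : ℂ) :
    Real.circleAverage (fun v => Real.log ‖v - x‖) 0 s = Real.log (max s ‖x‖) := by
  rw [circleAverage_log_norm_sub_const_eq_log_radius_add_posLog hs.ne', zero_sub, norm_neg]
  rcases le_total ‖x‖ s with h | h
  · rw [max_eq_left h, (Real.posLog_eq_zero_iff _).2, add_zero]
    rw [abs_of_nonneg (by positivity), inv_mul_le_one₀ hs]
    exact h
  · have hx : 0 < ‖x‖ := hs.trans_le h
    rw [max_eq_right h, Real.posLog_eq_log, Real.log_mul (inv_ne_zero hs.ne') hx.ne', Real.log_inv]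
    · ring
    · rw [abs_of_nonneg (by positivity), inv_mul_eq_div, one_le_div hs]
      exact h

/-- The free starting angle reconciles polar coordinates, which use (-π, π), with circle averages,
which use (0, 2π). -/
theorem lintegral_circleMap_eq {f : ℂ → ℝ} {c : ℂ} {r : ℝ} (hf : CircleIntegrable f c r)
    (h0 : ∀ z ∈ sphere c |r|, 0 ≤ f z) (a : ℝ) :
    ∫⁻ θ in Set.Ioc a (a + 2 * Real.pi), ENNReal.ofReal (f (circleMap c r θ)) =
      ENNReal.ofReal (2 * Real.pi * Real.circleAverage f c r) := by
  have hper : Function.Periodic (fun θ => f (circleMap c r θ)) (2 * Real.pi) :=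
    (periodic_circleMap c r).comp f
  have hi : IntervalIntegrable (fun θ => f (circleMap c r θ)) volume a (a + 2 * Real.pi) :=
    hper.intervalIntegrable₀ Real.two_pi_pos.ne' hf _ _
  have hle : a ≤ a + 2 * Real.pi := by linarith [Real.two_pi_pos]
  rw [Real.circleAverage, ← ofReal_integral_eq_lintegral_ofReal
    ((intervalIntegrable_iff_integrableOn_Ioc_of_le hle).1 hi)
    (ae_of_all _ fun θ => h0 _ (circleMap_mem_sphere' c r θ)),
    ← intervalIntegral.integral_of_le hle, hper.intervalIntegral_add_eq a 0, zero_add, smul_eq_mul,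
    mul_inv_cancel_left₀ Real.two_pi_pos.ne']

/-- Subtracting from log(2M) makes the kernel nonnegative, so Tonelli applies with no integrability
to check. The condition 1 ≤ M covers x = v, where `Real.log 0 = 0`. -/
theorem log_sub_log_norm_sub_nonneg {M : ℝ} (hM : 1 ≤ M) {x v : ℂ} (hx : ‖x‖ ≤ M) (hv : ‖v‖ ≤ M) :
    0 ≤ Real.log (2 * M) - Real.log ‖x - v‖ := by
  rw [sub_nonneg]
  rcases (norm_nonneg (x - v)).eq_or_lt with h | h
  · rw [← h, Real.log_zero]
    exact Real.log_nonneg (by linarith)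
  · refine Real.log_le_log h ?_
    linarith [norm_sub_le x v]

/-- The logarithmic potential of Lebesgue measure on a disk, inside that disk. -/
theorem lintegral_ball_log_sub_log_norm_sub {M : ℝ} (hM : 1 ≤ M) {x : ℂ} (hx : ‖x‖ ≤ M) :
    ∫⁻ v in ball (0 : ℂ) M, ENNReal.ofReal (Real.log (2 * M) - Real.log ‖x - v‖) =
      ENNReal.ofReal (Real.pi * (M ^ 2 * (Real.log 2 + 1 / 2) - ‖x‖ ^ 2 / 2)) := by
  have hM0 : 0 < M := by linarith
  set g : ℂ → ENNReal := fun v => ENNReal.ofReal (Real.log (2 * M) - Real.log ‖x - v‖) with hg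
  have hgm : Measurable g := by fun_prop
  rw [← lintegral_indicator measurableSet_ball, ← Complex.lintegral_comp_polarCoord_symm]
  have htarget : polarCoord.target = Set.Ioi (0 : ℝ) ×ˢ Set.Ioo (-Real.pi) Real.pi := rfl
  have hmeas : Measurable fun p : ℝ × ℝ => ENNReal.ofReal p.1 •
      (ball (0 : ℂ) M).indicator g (Complex.polarCoord.symm p) := by
    simp only [Complex.polarCoord_symm_apply, smul_eq_mul]
    refine (by fun_prop : Measurable fun p : ℝ × ℝ => ENNReal.ofReal p.1).mul ?_
    exact (hgm.indicator measurableSet_ball).comp (by fun_prop)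
  rw [htarget, Measure.volume_eq_prod, ← Measure.prod_restrict, lintegral_prod _ hmeas.aemeasurable]
  -- On the circle |v| = s the average of log|v - x| is log max(s, |x|); only a one-dimensional
  -- integral remains.
  have hinner : ∀ s ∈ Set.Ioi (0 : ℝ), ∫⁻ t in Set.Ioo (-Real.pi) Real.pi, ENNReal.ofReal s •
      (ball (0 : ℂ) M).indicator g (Complex.polarCoord.symm (s, t)) =
      (Set.Ioo 0 M).indicator (fun s => ENNReal.ofReal
        (2 * Real.pi * (s * (Real.log (2 * M) - Real.log (max s ‖x‖))))) s := by
    intro s hs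
    have hs : 0 < s := hs
    have hcm : ∀ t, Complex.polarCoord.symm (s, t) = circleMap 0 s t := by
      intro t
      rw [Complex.polarCoord_symm_apply, circleMap_zero, Complex.exp_mul_I]
      push_cast; rfl
    simp only [hcm, smul_eq_mul]
    by_cases hsM : s < M
    · have hball : ∀ t, circleMap 0 s t ∈ ball (0 : ℂ) M := by
        intro t; simp [abs_of_pos hs, hsM]
      simp only [Set.indicator_of_mem (hball _), hg]
      rw [Set.indicator_of_mem (show s ∈ Set.Ioo 0 M from ⟨hs, hsM⟩),
        lintegral_const_mul _ (by fun_prop), Measure.restrict_congr_set Ioo_ae_eq_Ioc]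
      have hci : CircleIntegrable (fun v => Real.log ‖v - x‖) 0 s :=
        circleIntegrable_log_norm_sub_const s
      have hL := lintegral_circleMap_eq (f := fun v => Real.log (2 * M) - Real.log ‖v - x‖)
        (c := 0) (r := s) ((circleIntegrable_const _ _ _).sub hci) ?_ (-Real.pi)
      · rw [show -Real.pi + 2 * Real.pi = Real.pi by ring] at hL
        simp only [norm_sub_rev x]
        rw [hL, Real.circleAverage_fun_sub (circleIntegrable_const _ _ _) hci,
          Real.circleAverage_const, circleAverage_log_norm_sub_eq_log_max hs,
          ← ENNReal.ofReal_mul hs.le]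
        congr 1; ring
      · intro z hz
        rw [mem_sphere_zero_iff_norm, abs_of_pos hs] at hz
        rw [norm_sub_rev]
        exact log_sub_log_norm_sub_nonneg hM hx (hz.trans_lt hsM).le
    · have hball : ∀ t, circleMap 0 s t ∉ ball (0 : ℂ) M := by
        intro t; simpa [abs_of_pos hs] using hsM
      simp only [Set.indicator_of_notMem (hball _)]
      rw [Set.indicator_of_notMem (by simp [hsM])]
      simp
  rw [setLIntegral_congr_fun measurableSet_Ioi hinner, lintegral_indicator measurableSet_Ioo,
    Measure.restrict_restrict measurableSet_Ioo, Set.inter_eq_left.2 (fun s hs => hs.1),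
    Measure.restrict_congr_set Ioo_ae_eq_Ioc, ← ofReal_integral_eq_lintegral_ofReal,
    ← intervalIntegral.integral_of_le hM0.le, intervalIntegral.integral_const_mul,
    integral_mul_log_sub_log_max (norm_nonneg x) hx hM0]
  · congr 1; ring
  · exact ((continuous_mul_log_sub_log_max (norm_nonneg x) M).const_mul _).integrableOn_Ioc
  · refine (ae_restrict_iff' measurableSet_Ioc).2 (ae_of_all _ fun s hs => ?_)
    have hmax : 0 < max s ‖x‖ := hs.1.trans_le (le_max_left _ _)
    have : 0 ≤ Real.log (2 * M) - Real.log (max s ‖x‖) :=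
      sub_nonneg.2 (Real.log_le_log hmax ((max_le hs.2 hx).trans (by linarith)))
    exact mul_nonneg Real.two_pi_pos.le (mul_nonneg hs.1.le this)

/-! ### Integrating the Jensen defect over all values -/

section JensenIntegral

variable {u : ℂ → ℂ} {c : ℂ} {r : ℝ}

/-- The parameter space `X` is a point when one circle is fixed, and the line of radii e^(-s) when
Tonelli is applied in (v, s). -/
theorem measurable_circleAverage_log_norm_sub {X : Type*} [MeasurableSpace X] {F : X → ℝ → ℂ}
    (hF : Measurable (Function.uncurry F)) :
    Measurable fun p : X × ℂ => (2 * Real.pi)⁻¹ •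
      ∫ θ in (0 : ℝ)..2 * Real.pi, Real.log ‖F p.1 θ - p.2‖ := by
  simp only [intervalIntegral.integral_of_le Real.two_pi_pos.le]
  simp only [smul_eq_mul]
  refine Measurable.const_mul (StronglyMeasurable.measurable ?_) _
  refine StronglyMeasurable.integral_prod_right
    (f := fun (p : X × ℂ) (θ : ℝ) => Real.log ‖F p.1 θ - p.2‖) ?_
  have h : Measurable fun q : (X × ℂ) × ℝ => F q.1.1 q.2 :=
    hF.comp (by fun_prop : Measurable fun q : (X × ℂ) × ℝ => (q.1.1, q.2))
  have h' : Measurable fun q : (X × ℂ) × ℝ => Real.log ‖F q.1.1 q.2 - q.1.2‖ :=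
    Real.measurable_log.comp (h.sub (by fun_prop)).norm
  exact h'.stronglyMeasurable

theorem measurable_jensenDefect (hu : ContinuousOn u (closedBall c r)) (hr : 0 < r) :
    Measurable (jensenDefect u c r) := by
  have hcont : Continuous fun θ => u (circleMap c r θ) :=
    hu.comp_continuous (continuous_circleMap c r)
      fun θ => circleMap_mem_closedBall c hr.le θ
  have h := (measurable_circleAverage_log_norm_sub (X := Unit)
    (F := fun _ θ => u (circleMap c r θ))
    (hcont.measurable.comp measurable_snd)).comp (measurable_prodMk_left (x := ()))
  exact h.sub (by fun_prop : Measurable fun v => Real.log ‖u c - v‖)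

theorem circleAverage_const_mul (a : ℝ) (f : ℂ → ℝ) (c : ℂ) (r : ℝ) :
    Real.circleAverage (fun z => a * f z) c r = a * Real.circleAverage f c r := by
  simp only [Real.circleAverage, intervalIntegral.integral_const_mul, smul_eq_mul]
  ring

theorem circleIntegrable_norm_sq (hu : ContinuousOn u (closedBall c r)) (hr : 0 < r) :
    CircleIntegrable (fun z => ‖u z‖ ^ 2) c r :=
  ((hu.mono sphere_subset_closedBall).norm.pow 2).circleIntegrable hr.le

/-- Tonelli in v and θ reduces this to the potential at x = u(c + re^(iθ)), which is a constant
minus (π/2)|x|²; averaging over θ produces the mean of |u|². -/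
theorem lintegral_ball_circleAverage_log_norm_sub (hu : AnalyticOnNhd ℂ u (closedBall c r))
    (hr : 0 < r) {M : ℝ} (hM : 1 ≤ M) (hb : ∀ z ∈ closedBall c r, ‖u z‖ < M) :
    ∫⁻ v in ball (0 : ℂ) M, ENNReal.ofReal
        (Real.log (2 * M) - Real.circleAverage (fun z => Real.log ‖u z - v‖) c r) =
      ENNReal.ofReal (Real.pi * (M ^ 2 * (Real.log 2 + 1 / 2) -
        Real.circleAverage (fun z => ‖u z‖ ^ 2) c r / 2)) := by
  have hsph : ∀ z ∈ sphere c |r|, ‖u z‖ < M := fun z hz =>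
    hb z (sphere_subset_closedBall (by rwa [abs_of_pos hr] at hz))
  have hcont : Continuous fun θ => u (circleMap c r θ) :=
    hu.continuousOn.comp_continuous (continuous_circleMap c r)
      fun θ => circleMap_mem_closedBall c hr.le θ
  have hsq := circleIntegrable_norm_sq hu.continuousOn hr
  have h2pi := Real.two_pi_pos
  have hC : ENNReal.ofReal (2 * Real.pi) ≠ 0 := by simp [Real.pi_pos]
  rw [← ENNReal.mul_right_inj hC ENNReal.ofReal_ne_top, ← lintegral_const_mul' _ _
    ENNReal.ofReal_ne_top]
  have h1 : ∀ v ∈ ball (0 : ℂ) M, ENNReal.ofReal (2 * Real.pi) * ENNReal.ofReal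
        (Real.log (2 * M) - Real.circleAverage (fun z => Real.log ‖u z - v‖) c r) =
      ∫⁻ θ in Set.Ioc (0 : ℝ) (0 + 2 * Real.pi),
        ENNReal.ofReal (Real.log (2 * M) - Real.log ‖u (circleMap c r θ) - v‖) := by
    intro v hv
    have hci := circleIntegrable_log_norm_sub hu hr v
    rw [lintegral_circleMap_eq (f := fun z => Real.log (2 * M) - Real.log ‖u z - v‖)
      ((circleIntegrable_const _ _ _).sub hci),
      Real.circleAverage_fun_sub (circleIntegrable_const _ _ _) hci,
      Real.circleAverage_const, ← ENNReal.ofReal_mul h2pi.le]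
    exact fun z hz => log_sub_log_norm_sub_nonneg hM (hsph z hz).le (mem_ball_zero_iff.1 hv).le
  rw [setLIntegral_congr_fun measurableSet_ball h1, lintegral_lintegral_swap]
  · have h2 : ∀ θ : ℝ, ∫⁻ v in ball (0 : ℂ) M,
        ENNReal.ofReal (Real.log (2 * M) - Real.log ‖u (circleMap c r θ) - v‖) =
        ENNReal.ofReal (Real.pi * (M ^ 2 * (Real.log 2 + 1 / 2) -
          ‖u (circleMap c r θ)‖ ^ 2 / 2)) := fun θ =>
      lintegral_ball_log_sub_log_norm_sub hM (hsph _ (circleMap_mem_sphere' c r θ)).le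
    simp only [h2]
    have hsq' : CircleIntegrable (fun z => Real.pi / 2 * ‖u z‖ ^ 2) c r := hsq.const_mul _
    have hd : CircleIntegrable (fun z => Real.pi * (M ^ 2 * (Real.log 2 + 1 / 2)) -
        Real.pi / 2 * ‖u z‖ ^ 2) c r :=
      (circleIntegrable_const _ _ _).sub hsq'
    have h3 := lintegral_circleMap_eq hd ?_ 0
    · rw [Real.circleAverage_fun_sub (circleIntegrable_const _ _ _) hsq',
        Real.circleAverage_const] at h3
      rw [circleAverage_const_mul] at h3
      rw [← ENNReal.ofReal_mul h2pi.le]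
      convert h3 using 4 <;> ring
    · intro z hz
      have h5 : ‖u z‖ ^ 2 ≤ M ^ 2 := by
        have := (hsph z hz).le
        gcongr
      have h6 := Real.log_pos one_lt_two
      have : 0 ≤ M ^ 2 * Real.log 2 := by positivity
      nlinarith [Real.pi_pos]
  · refine Measurable.aemeasurable ?_
    have := hcont.measurable
    have h' : Measurable fun q : ℂ × ℝ => ‖u (circleMap c r q.2) - q.1‖ :=
      ((this.comp measurable_snd).sub measurable_fst).norm
    exact (measurable_const.sub (Real.measurable_log.comp h')).ennreal_ofReal

/-- The integral over all values `v` of the difference of the two sides of Jensen's inequality. -/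
theorem lintegral_jensenDefect (hu : AnalyticOnNhd ℂ u (closedBall c r)) (hr : 0 < r) :
    ∫⁻ v, ENNReal.ofReal (jensenDefect u c r v) =
      ENNReal.ofReal (Real.pi / 2 * (Real.circleAverage (fun z => ‖u z‖ ^ 2) c r - ‖u c‖ ^ 2)) := by
  obtain ⟨B, hB⟩ := (isCompact_closedBall c r).exists_bound_of_continuousOn hu.continuousOn
  set M := max B 0 + 1 with hMdef
  have hM : 1 ≤ M := by simp [hMdef]
  have hb : ∀ z ∈ closedBall c r, ‖u z‖ < M := fun z hz =>
    (hB z hz).trans_lt ((le_max_left B 0).trans_lt (lt_add_one _))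
  have hc : c ∈ closedBall c r := by simp [hr.le]
  -- Values of modulus at least M are not attained on the closed disk, so the defect vanishes there
  -- and the integral localizes.
  have hout : ∀ v ∉ ball (0 : ℂ) M, jensenDefect u c r v = 0 := by
    intro v hv
    refine jensenDefect_eq_zero hu hr fun z hz h => hv ?_
    rw [← h]; simpa using hb z hz
  have hind : (fun v => ENNReal.ofReal (jensenDefect u c r v)) =
      (ball (0 : ℂ) M).indicator fun v => ENNReal.ofReal (jensenDefect u c r v) := by
    funext v
    by_cases hv : v ∈ ball (0 : ℂ) M
    · rw [Set.indicator_of_mem hv]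
    · rw [Set.indicator_of_notMem hv, hout v hv]; simp
  rw [hind, lintegral_indicator measurableSet_ball]
  have hA := lintegral_ball_circleAverage_log_norm_sub hu hr hM hb
  have hB' := lintegral_ball_log_sub_log_norm_sub hM (hb c hc).le
  -- The identity is arranged as a sum of nonnegative terms, so that the single subtraction in
  -- `ENNReal` happens at the end. The value v = u(c), where Jensen's formula is unavailable, is a
  -- null set.
  have hsum : ∫⁻ v in ball (0 : ℂ) M, (ENNReal.ofReal (jensenDefect u c r v) + ENNReal.ofReal
        (Real.log (2 * M) - Real.circleAverage (fun z => Real.log ‖u z - v‖) c r)) =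
      ∫⁻ v in ball (0 : ℂ) M, ENNReal.ofReal (Real.log (2 * M) - Real.log ‖u c - v‖) := by
    refine lintegral_congr_ae ?_
    have hne : ∀ᵐ v ∂(volume.restrict (ball (0 : ℂ) M)), v ≠ u c :=
      ae_restrict_of_ae (by simp [ae_iff])
    filter_upwards [hne, ae_restrict_mem measurableSet_ball] with v hv hvM
    rw [← ENNReal.ofReal_add (jensenDefect_nonneg hu hr hv)]
    · rw [jensenDefect]; congr 1; ring
    · have hci := circleIntegrable_log_norm_sub hu hr v
      rw [← Real.circleAverage_const (Real.log (2 * M)) c r,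
        ← Real.circleAverage_fun_sub (circleIntegrable_const _ _ _) hci]
      refine Real.circleAverage_nonneg_of_nonneg fun z hz => ?_
      exact log_sub_log_norm_sub_nonneg hM
        (hb z (sphere_subset_closedBall (by rwa [abs_of_pos hr] at hz))).le (mem_ball_zero_iff.1 hvM).le
  have hcirc : 0 ≤ M ^ 2 * (Real.log 2 + 1 / 2) -
      Real.circleAverage (fun z => ‖u z‖ ^ 2) c r / 2 := by
    have h1 : Real.circleAverage (fun z => ‖u z‖ ^ 2) c r ≤ M ^ 2 := by
      refine Real.circleAverage_mono_on_of_le_circle (circleIntegrable_norm_sq hu.continuousOn hr) ?_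
      intro z hz
      have := (hb z (sphere_subset_closedBall (by rwa [abs_of_pos hr] at hz))).le
      gcongr
    have h6 := Real.log_pos one_lt_two
    have : 0 ≤ M ^ 2 * Real.log 2 := by positivity
    linarith
  rw [lintegral_add_left ((measurable_jensenDefect hu.continuousOn hr).ennreal_ofReal), hA, hB'] at hsum
  rw [ENNReal.eq_sub_of_add_eq ENNReal.ofReal_ne_top hsum,
    ← ENNReal.ofReal_sub _ (mul_nonneg Real.pi_pos.le hcirc)]
  congr 1; ring

end JensenIntegral

/-! ### Taylor coefficients and the identification of H² with ℓ² -/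

/-- The `k`-th Taylor coefficient at the origin. -/
noncomputable def taylorCoeff (f : ℂ → ℂ) (k : ℕ) : ℂ :=
  (k.factorial : ℂ)⁻¹ * iteratedDeriv k f 0

theorem differentiableOn_iteratedDeriv {f : ℂ → ℂ} {s : Set ℂ} (hs : IsOpen s)
    (hf : DifferentiableOn ℂ f s) (n : ℕ) : DifferentiableOn ℂ (iteratedDeriv n f) s := by
  rw [iteratedDeriv_eq_iterate]
  exact ((hf.analyticOnNhd hs).iterated_deriv n).differentiableOn

theorem taylorCoeff_iteratedDeriv (f : ℂ → ℂ) (n k : ℕ) :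
    taylorCoeff (iteratedDeriv n f) k =
      ((k + n).factorial / k.factorial : ℂ) * taylorCoeff f (k + n) := by
  have h : iteratedDeriv k (iteratedDeriv n f) = iteratedDeriv (k + n) f := by
    simp only [iteratedDeriv_eq_iterate, Function.iterate_add_apply]
  have h1 : ((k + n).factorial : ℂ) ≠ 0 := by exact_mod_cast (k + n).factorial_ne_zero
  rw [taylorCoeff, taylorCoeff, h]
  field_simp

/-- The factor (k+n)!/k! is a product of n integers, each at most k + n. -/
theorem norm_taylorCoeff_iteratedDeriv_le (f : ℂ → ℂ) (n k : ℕ) :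
    ‖taylorCoeff (iteratedDeriv n f) k‖ ≤ ((k + n : ℕ) : ℝ) ^ n * ‖taylorCoeff f (k + n)‖ := by
  rw [taylorCoeff_iteratedDeriv, norm_mul]
  gcongr
  have hk : (0 : ℝ) < k.factorial := by exact_mod_cast k.factorial_pos
  rw [norm_div, Complex.norm_natCast, Complex.norm_natCast, div_le_iff₀ hk]
  have h2 : (k + n).factorial ≤ k.factorial * (k + n) ^ n := by
    rw [← Nat.factorial_mul_ascFactorial]
    exact Nat.mul_le_mul_left _ (Nat.ascFactorial_le_pow_add k n)
  calc ((k + n).factorial : ℝ) ≤ ((k.factorial * (k + n) ^ n : ℕ) : ℝ) := by exact_mod_cast h2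
    _ = _ := by push_cast; ring

theorem hasSum_taylorCoeff {f : ℂ → ℂ} (hf : DifferentiableOn ℂ f (ball 0 1)) {z : ℂ}
    (hz : z ∈ ball (0 : ℂ) 1) : HasSum (fun k => taylorCoeff f k * z ^ k) (f z) := by
  convert! Complex.hasSum_taylorSeries_on_ball hf hz using 2 with k
  simp [taylorCoeff]; ring

/-- Each finite part of Parseval's series is continuous in r, so the bound survives r → 1. -/
theorem summable_norm_taylorCoeff_sq {f : ℂ → ℂ} (hf : DifferentiableOn ℂ f (ball 0 1)) {C : ℝ}
    (hC : ∀ r ∈ Set.Ico (0 : ℝ) 1, hardyMean f r ≤ C) :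
    Summable (fun k => ‖taylorCoeff f k‖ ^ 2) ∧ ∑' k, ‖taylorCoeff f k‖ ^ 2 ≤ C := by
  have key : ∀ s : Finset ℕ, ∑ k ∈ s, ‖taylorCoeff f k‖ ^ 2 ≤ C := by
    intro s
    have h1 : ∀ r ∈ Set.Ico (0 : ℝ) 1, ∑ k ∈ s, ‖taylorCoeff f k‖ ^ 2 * r ^ (2 * k) ≤ C :=
      fun r hr => (sum_le_hasSum s (fun k _ => by have := hr.1; positivity)
        (hasSum_hardyMean hf hr)).trans (hC r hr)
    have h2 : Tendsto (fun r : ℝ => ∑ k ∈ s, ‖taylorCoeff f k‖ ^ 2 * r ^ (2 * k)) (𝓝[<] 1)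
        (𝓝 (∑ k ∈ s, ‖taylorCoeff f k‖ ^ 2 * 1 ^ (2 * k))) :=
      (Continuous.tendsto (by fun_prop) 1).mono_left nhdsWithin_le_nhds
    simp only [one_pow, mul_one] at h2
    refine le_of_tendsto h2 ?_
    filter_upwards [Ico_mem_nhdsLT (zero_lt_one' ℝ)] with r hr using h1 r hr
  have hs : Summable (fun k => ‖taylorCoeff f k‖ ^ 2) :=
    summable_of_sum_le (fun k => by positivity) key
  exact ⟨hs, hs.tsum_le_of_sum_le key⟩

theorem hardyMean_le_tsum {f : ℂ → ℂ} (hf : DifferentiableOn ℂ f (ball 0 1))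
    (hs : Summable (fun k => ‖taylorCoeff f k‖ ^ 2)) {r : ℝ} (hr : r ∈ Set.Ico (0 : ℝ) 1) :
    hardyMean f r ≤ ∑' k, ‖taylorCoeff f k‖ ^ 2 :=
  hasSum_le (fun k => mul_le_of_le_one_right (by positivity) (pow_le_one₀ hr.1 hr.2.le))
    (hasSum_hardyMean hf hr) hs.hasSum

theorem taylorCoeff_congr {f g : ℂ → ℂ} (h : Set.EqOn f g (ball 0 1)) (k : ℕ) :
    taylorCoeff f k = taylorCoeff g k := by
  have : f =ᶠ[𝓝 0] g := h.eventuallyEq_of_mem (ball_mem_nhds 0 one_pos)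
  rw [taylorCoeff, taylorCoeff, this.iteratedDeriv_eq]

theorem hardyMean_congr {f g : ℂ → ℂ} (h : Set.EqOn f g (ball 0 1)) {r : ℝ}
    (hr : r ∈ Set.Ico (0 : ℝ) 1) : hardyMean f r = hardyMean g r := by
  refine Real.circleAverage_congr_sphere fun z hz => ?_
  rw [mem_sphere_zero_iff_norm, abs_of_nonneg hr.1] at hz
  simp only [h (mem_ball_zero_iff.2 (hz.trans_lt hr.2))]

/-- The function `∑ aₖ zᵏ` for a bounded sequence `a`. -/
theorem exists_differentiableOn_hasSum {a : ℕ → ℂ} {C : ℝ} (ha : ∀ k, ‖a k‖ ≤ C) :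
    ∃ g : ℂ → ℂ, DifferentiableOn ℂ g (ball 0 1) ∧ ∀ k, taylorCoeff g k = a k := by
  set p := FormalMultilinearSeries.ofScalars ℂ a with hp
  have hrad : (1 : ENNReal) ≤ p.radius := by
    have := p.le_radius_of_bound C (r := 1) fun k => by
      simpa [hp, FormalMultilinearSeries.ofScalars_norm] using ha k
    simpa using this
  have hps := p.hasFPowerSeriesOnBall (one_pos.trans_le hrad)
  refine ⟨p.sum, hps.differentiableOn.mono fun z hz => ?_, fun k => ?_⟩
  · refine Metric.eball_subset_eball hrad ?_
    rw [← ENNReal.ofReal_one, Metric.eball_ofReal]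
    exact hz
  · have h := hps.factorial_smul 1 k
    rw [← iteratedDeriv_eq_iteratedFDeriv] at h
    have hk : (k.factorial : ℂ) ≠ 0 := by exact_mod_cast k.factorial_ne_zero
    rw [taylorCoeff, ← h]
    simp [hp, FormalMultilinearSeries.ofScalars, hk]

namespace HardySpace

theorem summable_norm_taylorCoeff_sq (f : HardySpace) :
    Summable fun k => ‖taylorCoeff f k‖ ^ 2 :=
  (_root_.summable_norm_taylorCoeff_sq f.differentiableOn fun _ hr =>
    hardyMean_le_of_tendsto f.differentiableOn f.tendsto_hardyMean hr).1

/-- Parseval's identity in `H²`. -/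
theorem norm_sq_eq_tsum (f : HardySpace) : ‖f‖ ^ 2 = ∑' k, ‖taylorCoeff f k‖ ^ 2 := by
  refine le_antisymm ?_ (_root_.summable_norm_taylorCoeff_sq f.differentiableOn fun _ hr =>
    hardyMean_le_of_tendsto f.differentiableOn f.tendsto_hardyMean hr).2
  refine le_of_tendsto f.tendsto_hardyMean ?_
  filter_upwards [Ico_mem_nhdsLT (zero_lt_one' ℝ)] with r hr
  exact hardyMean_le_tsum f.differentiableOn f.summable_norm_taylorCoeff_sq hr

theorem hardyMean_le (f : HardySpace) {r : ℝ} (hr : r ∈ Set.Ico (0 : ℝ) 1) :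
    hardyMean f r ≤ ‖f‖ ^ 2 :=
  hardyMean_le_of_tendsto f.differentiableOn f.tendsto_hardyMean hr

theorem norm_taylorCoeff_le (f : HardySpace) (k : ℕ) : ‖taylorCoeff f k‖ ≤ ‖f‖ := by
  refine (sq_le_sq₀ (norm_nonneg _) (norm_nonneg _)).1 ?_
  rw [norm_sq_eq_tsum]
  exact f.summable_norm_taylorCoeff_sq.le_tsum k fun _ _ => by positivity

theorem contDiffAt (f : HardySpace) {z : ℂ} (hz : z ∈ ball (0 : ℂ) 1) (n : ℕ) :
    ContDiffAt ℂ n f z :=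
  (f.differentiableOn.analyticAt (isOpen_ball.mem_nhds hz)).contDiffAt

theorem iteratedDeriv_add (f g : HardySpace) {z : ℂ} (hz : z ∈ ball (0 : ℂ) 1) (n : ℕ) :
    iteratedDeriv n (f + g : HardySpace) z = iteratedDeriv n f z + iteratedDeriv n g z :=
  _root_.iteratedDeriv_add (f.contDiffAt hz n) (g.contDiffAt hz n)

theorem iteratedDeriv_smul (a : ℂ) (f : HardySpace) (z : ℂ) (n : ℕ) :
    iteratedDeriv n (a • f : HardySpace) z = a * iteratedDeriv n f z :=
  iteratedDeriv_const_smul_field a f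

theorem taylorCoeff_add (f g : HardySpace) (k : ℕ) :
    taylorCoeff (f + g : HardySpace) k = taylorCoeff f k + taylorCoeff g k := by
  rw [taylorCoeff, iteratedDeriv_add f g (by simp) k, mul_add]; rfl

theorem taylorCoeff_smul (a : ℂ) (f : HardySpace) (k : ℕ) :
    taylorCoeff (a • f : HardySpace) k = a * taylorCoeff f k := by
  rw [taylorCoeff, iteratedDeriv_smul, taylorCoeff]; ring

/-- An element of `H²` from a function on the disk with bounded integral means. -/
theorem exists_of_hardyMean_le {g : ℂ → ℂ} (hg : DifferentiableOn ℂ g (ball 0 1)) {C : ℝ}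
    (hC : ∀ r ∈ Set.Ico (0 : ℝ) 1, hardyMean g r ≤ C) :
    ∃ f : HardySpace, Set.EqOn f g (ball 0 1) ∧ ‖f‖ ^ 2 ≤ C := by
  classical
  have he : Set.EqOn ((ball (0 : ℂ) 1).indicator g) g (ball 0 1) :=
    fun z hz => Set.indicator_of_mem hz g
  have hd : DifferentiableOn ℂ ((ball (0 : ℂ) 1).indicator g) (ball 0 1) := hg.congr he
  have hC' : ∀ r ∈ Set.Ico (0 : ℝ) 1, hardyMean ((ball (0 : ℂ) 1).indicator g) r ≤ C :=
    fun r hr => (hardyMean_congr he hr).trans_le (hC r hr)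
  let f : HardySpace := ⟨(ball (0 : ℂ) 1).indicator g, hd,
    fun z hz => Set.indicator_of_notMem hz g, exists_tendsto_hardyMean hd hC'⟩
  refine ⟨f, he, le_of_tendsto f.tendsto_hardyMean ?_⟩
  filter_upwards [Ico_mem_nhdsLT (zero_lt_one' ℝ)] with r hr using hC' r hr

theorem exists_taylorCoeff_eq {a : ℕ → ℂ} (ha : Summable fun k => ‖a k‖ ^ 2) :
    ∃ f : HardySpace, ∀ k, taylorCoeff f k = a k := by
  have hb : ∀ k, ‖a k‖ ≤ √(∑' k, ‖a k‖ ^ 2) := fun k =>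
    Real.le_sqrt_of_sq_le (ha.le_tsum k fun _ _ => by positivity)
  obtain ⟨g, hg, hga⟩ := exists_differentiableOn_hasSum hb
  have hs : Summable (fun k => ‖taylorCoeff g k‖ ^ 2) := by simpa only [hga] using ha
  obtain ⟨f, hf, -⟩ := exists_of_hardyMean_le hg fun r hr => hardyMean_le_tsum hg hs hr
  exact ⟨f, fun k => (taylorCoeff_congr hf k).trans (hga k)⟩

theorem memℓp_taylorCoeff (f : HardySpace) : Memℓp (taylorCoeff f) 2 :=
  memℓp_gen (by simpa using f.summable_norm_taylorCoeff_sq)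

/-- The Taylor coefficients, as a linear isometry onto `ℓ²`. -/
noncomputable def toLp : HardySpace →ₗᵢ[ℂ] lp (fun _ : ℕ => ℂ) 2 where
  toFun f := ⟨taylorCoeff f, f.memℓp_taylorCoeff⟩
  map_add' f g := Subtype.ext (funext (taylorCoeff_add f g))
  map_smul' a f := Subtype.ext (funext (taylorCoeff_smul a f))
  norm_map' f := by
    have h := lp.norm_rpow_eq_tsum (p := 2) (by simp)
      (⟨taylorCoeff f, f.memℓp_taylorCoeff⟩ : lp (fun _ : ℕ => ℂ) 2)
    simp only [ENNReal.toReal_ofNat, Real.rpow_ofNat] at h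
    exact (pow_left_inj₀ (norm_nonneg _) (norm_nonneg _) two_ne_zero).1
      (h.trans f.norm_sq_eq_tsum.symm)

theorem toLp_surjective : Function.Surjective toLp := by
  intro a
  have ha : Summable fun k => ‖a k‖ ^ 2 := by
    simpa using (lp.memℓp a).summable (by simp)
  obtain ⟨f, hf⟩ := exists_taylorCoeff_eq ha
  exact ⟨f, Subtype.ext (funext hf)⟩

/-- Completeness comes from ℓ²; it is what makes norm limits of compact operators compact in the
sufficiency half. -/
instance : CompleteSpace HardySpace :=
  (LinearIsometryEquiv.ofSurjective toLp toLp_surjective).toIsometryEquiv.completeSpace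

theorem ext_taylorCoeff {f g : HardySpace} (h : ∀ k, taylorCoeff f k = taylorCoeff g k) : f = g :=
  toLp.injective (Subtype.ext (funext h))

/-- The `k`-th Taylor coefficient as a continuous functional. -/
noncomputable def coeffCLM (k : ℕ) : HardySpace →L[ℂ] ℂ :=
  LinearMap.mkContinuous
    { toFun := fun f => taylorCoeff f k
      map_add' := fun f g => taylorCoeff_add f g k
      map_smul' := fun a f => taylorCoeff_smul a f k } 1
    fun f => by simpa using f.norm_taylorCoeff_le k

@[simp]
theorem coeffCLM_apply (k : ℕ) (f : HardySpace) : coeffCLM k f = taylorCoeff f k := rfl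

/-- The constant is crude, but only continuity of point evaluations is used: it identifies cluster
points in the necessity half. -/
theorem norm_apply_le (f : HardySpace) {z : ℂ} (hz : z ∈ ball (0 : ℂ) 1) :
    ‖f z‖ ≤ (1 - ‖z‖)⁻¹ * ‖f‖ := by
  have hz' := mem_ball_zero_iff.1 hz
  have hg := (hasSum_geometric_of_lt_one (norm_nonneg z) hz').mul_right ‖f‖
  refine (hasSum_taylorCoeff f.differentiableOn hz).tsum_eq ▸ tsum_of_norm_bounded hg fun k => ?_
  rw [norm_mul, norm_pow, mul_comm]
  gcongr
  exact f.norm_taylorCoeff_le k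

theorem continuous_apply {z : ℂ} (hz : z ∈ ball (0 : ℂ) 1) :
    Continuous fun f : HardySpace => f z := by
  let L : HardySpace →L[ℂ] ℂ := LinearMap.mkContinuous
    { toFun := fun f => f z
      map_add' := fun f g => rfl
      map_smul' := fun a f => rfl } (1 - ‖z‖)⁻¹ fun f => f.norm_apply_le hz
  exact L.continuous

theorem eq_zero_of_forall_apply {f : HardySpace} (h : ∀ z ∈ ball (0 : ℂ) 1, f z = 0) : f = 0 := by
  refine Subtype.ext (funext fun z => ?_)
  by_cases hz : z ∈ ball (0 : ℂ) 1
  · exact h z hz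
  · exact f.2.2.1 z hz

end HardySpace

/-! ### A quadratic upper bound for the Jensen defect -/

section JensenUpper

variable {u : ℂ → ℂ} {c : ℂ} {r : ℝ} {v : ℂ}

/-- This is the second-order expansion of log|1 - x|, obtained from log t ≤ t - 1 at t = 1/|1 - x|².
The constant is 10 = (5/2)·4: 5/2 bounds |1 - |1 - x|²| by a multiple of |x|, and 4 bounds t. -/
theorem neg_re_sub_log_norm_one_sub_le {x : ℂ} (hx : ‖x‖ ≤ 1 / 2) :
    -x.re - Real.log ‖1 - x‖ ≤ 10 * ‖x‖ ^ 2 := by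
  have h1 : ‖1 - x‖ ^ 2 = 1 - 2 * x.re + ‖x‖ ^ 2 := by
    rw [← Complex.normSq_eq_norm_sq, ← Complex.normSq_eq_norm_sq, Complex.normSq_apply,
      Complex.normSq_apply]
    simp; ring
  have h2 : 1 / 2 ≤ ‖1 - x‖ := by
    have := norm_sub_norm_le (1 : ℂ) x
    rw [norm_one] at this; linarith
  have hy : 1 / 4 ≤ ‖1 - x‖ ^ 2 := by nlinarith
  have hy0 : 0 < ‖1 - x‖ ^ 2 := by linarith
  have h3 := Real.log_le_sub_one_of_pos (inv_pos.2 hy0)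
  rw [Real.log_inv, Real.log_pow] at h3
  push_cast at h3
  have h4 : |x.re| ≤ ‖x‖ := Complex.abs_re_le_norm x
  have hre := abs_le.1 h4
  set y := ‖1 - x‖ ^ 2 with hydef
  have h5 : (y⁻¹ - 1) / 2 - x.re ≤ 10 * ‖x‖ ^ 2 := by
    have h6 : (y⁻¹ - 1) / 2 - x.re = (x.re * (1 - y) - ‖x‖ ^ 2 / 2) * y⁻¹ := by
      field_simp; rw [h1]; ring
    have h7 : x.re * (1 - y) - ‖x‖ ^ 2 / 2 ≤ 5 / 2 * ‖x‖ ^ 2 := by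
      have h8 : x.re * (1 - y) ≤ ‖x‖ * (5 / 2 * ‖x‖) := by
        refine (le_abs_self _).trans ?_
        rw [abs_mul]
        refine mul_le_mul h4 ?_ (abs_nonneg _) (norm_nonneg _)
        rw [h1, abs_le]
        constructor <;> nlinarith [norm_nonneg x]
      nlinarith [norm_nonneg x]
    have h9 : y⁻¹ ≤ 4 := by
      rw [inv_le_comm₀ hy0 (by norm_num)]; linarith
    have h10 : 0 ≤ y⁻¹ := by positivity
    rw [h6]
    nlinarith [sq_nonneg ‖x‖]
  linarith

theorem circleAverage_re (hu : AnalyticOnNhd ℂ u (closedBall c r)) (hr : 0 < r) :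
    Real.circleAverage (fun z => (u z).re) c r = (u c).re := by
  have h : DiffContOnCl ℂ u (ball c |r|) := by
    rw [abs_of_pos hr]
    exact hu.differentiableOn.diffContOnCl_ball subset_rfl
  have hci : CircleIntegrable u c r :=
    (hu.continuousOn.mono sphere_subset_closedBall).circleIntegrable hr.le
  have := Complex.reCLM.circleAverage_comp_comm hci
  rw [h.circleAverage] at this
  exact this

/-- Apply log y ≤ y - 1 with y = |1 - u/v|² pointwise, then average; the linear term Re(u/v) is
harmonic and takes its value at the centre. -/
theorem circleAverage_log_norm_sub_le (hu : AnalyticOnNhd ℂ u (closedBall c r)) (hr : 0 < r)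
    (hv : v ≠ 0) (hvu : v ≠ u c) :
    Real.circleAverage (fun z => Real.log ‖u z - v‖) c r ≤ Real.log ‖v‖ - (u c / v).re +
      Real.circleAverage (fun z => ‖u z‖ ^ 2) c r / (2 * ‖v‖ ^ 2) := by
  have hv0 : 0 < ‖v‖ := norm_pos_iff.2 hv
  set B : ℂ → ℝ := fun z => (Real.log ‖v‖ - (u z / v).re) + (2 * ‖v‖ ^ 2)⁻¹ * ‖u z‖ ^ 2 with hB
  have hle : ∀ z, u z ≠ v → Real.log ‖u z - v‖ ≤ B z := by
    intro z hz
    have h0 : 0 < ‖1 - u z / v‖ := by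
      rw [norm_pos_iff, sub_ne_zero, Ne, eq_comm, div_eq_one_iff_eq hv]; exact hz
    have h1 : ‖u z - v‖ = ‖v‖ * ‖1 - u z / v‖ := by
      rw [← norm_mul, ← norm_neg]; congr 1; field_simp; ring
    have h2 : ‖1 - u z / v‖ ^ 2 = 1 - 2 * (u z / v).re + ‖u z / v‖ ^ 2 := by
      rw [← Complex.normSq_eq_norm_sq, ← Complex.normSq_eq_norm_sq, Complex.normSq_apply,
        Complex.normSq_apply]
      simp only [Complex.sub_re, Complex.one_re, Complex.sub_im, Complex.one_im]; ring
    have h3 := Real.log_le_sub_one_of_pos (pow_pos h0 2)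
    rw [Real.log_pow, h2, norm_div, div_pow] at h3
    rw [h1, Real.log_mul hv0.ne' h0.ne', hB]
    have h4 : (2 * ‖v‖ ^ 2)⁻¹ * ‖u z‖ ^ 2 = ‖u z‖ ^ 2 / ‖v‖ ^ 2 / 2 := by field_simp
    simp only [h4]
    push_cast at h3
    linarith
  -- Since `Real.log 0 = 0`, the pointwise bound may fail where u = v. Such points are discrete, so
  -- replacing the integrand by its minimum with the bound does not change the average.
  have hev : (fun z => Real.log ‖u z - v‖) =ᶠ[codiscreteWithin (sphere c |r|)]
      fun z => min (Real.log ‖u z - v‖) (B z) := by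
    have ha : AnalyticOnNhd ℂ (fun ζ => u ζ - v) (closedBall c r) := hu.sub analyticOnNhd_const
    have hcod := ha.preimage_zero_mem_codiscreteWithin (x := c) (sub_ne_zero.2 hvu.symm)
      (by simp [hr.le]) ⟨⟨c, by simp [hr.le]⟩, (convex_closedBall c r).isPreconnected⟩
    rw [abs_of_pos hr]
    filter_upwards [codiscreteWithin_mono sphere_subset_closedBall hcod] with z hz
    refine (min_eq_left (hle z ?_)).symm
    simpa [sub_eq_zero] using hz
  have hci := circleIntegrable_log_norm_sub hu hr v
  have hci' := hci.congr_codiscreteWithin hev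
  have hq : AnalyticOnNhd ℂ (fun z => u z / v) (closedBall c r) := hu.div_const
  have hre : CircleIntegrable (fun z => (u z / v).re) c r :=
    ((Complex.continuous_re.comp_continuousOn hq.continuousOn).mono
      sphere_subset_closedBall).circleIntegrable hr.le
  have hsq : CircleIntegrable (fun z => (2 * ‖v‖ ^ 2)⁻¹ * ‖u z‖ ^ 2) c r :=
    (circleIntegrable_norm_sq hu.continuousOn hr).const_mul _
  have hlin : CircleIntegrable (fun z => Real.log ‖v‖ - (u z / v).re) c r :=
    (circleIntegrable_const _ _ _).sub hre
  rw [Real.circleAverage_congr_codiscreteWithin hev hr.ne']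
  refine (Real.circleAverage_mono hci' (hlin.add hsq) fun z _ => min_le_right _ _).trans_eq ?_
  rw [Real.circleAverage_add hlin hsq, circleAverage_const_mul,
    Real.circleAverage_fun_sub (circleIntegrable_const _ _ _) hre, Real.circleAverage_const,
    circleAverage_re hq hr, inv_mul_eq_div]

/-- The first-order terms Re(u(c)/v) in the bound for the average and in the expansion of log|u(c) -
v| cancel, leaving only quadratic ones. -/
theorem jensenDefect_le (hu : AnalyticOnNhd ℂ u (closedBall c r)) (hr : 0 < r)
    (hv : v ≠ 0) (huv : ‖u c‖ ≤ ‖v‖ / 2) :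
    jensenDefect u c r v ≤
      (Real.circleAverage (fun z => ‖u z‖ ^ 2) c r / 2 + 10 * ‖u c‖ ^ 2) / ‖v‖ ^ 2 := by
  have hv0 : 0 < ‖v‖ := norm_pos_iff.2 hv
  have hne : v ≠ u c := by rintro rfl; linarith
  have h1 := circleAverage_log_norm_sub_le hu hr hv hne
  have hx : ‖u c / v‖ ≤ 1 / 2 := by
    rw [norm_div, div_le_iff₀ hv0]; linarith
  have h2 := neg_re_sub_log_norm_one_sub_le hx
  have h3 : ‖u c - v‖ = ‖v‖ * ‖1 - u c / v‖ := by
    rw [← norm_mul, ← norm_neg]; congr 1; field_simp; ring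
  have h4 : ‖1 - u c / v‖ ≠ 0 := by
    rw [norm_ne_zero_iff, sub_ne_zero, Ne, eq_comm, div_eq_one_iff_eq hv]; exact hne.symm
  rw [jensenDefect, h3, Real.log_mul hv0.ne' h4]
  rw [norm_div, div_pow] at h2
  have h5 : (Real.circleAverage (fun z => ‖u z‖ ^ 2) c r / 2 + 10 * ‖u c‖ ^ 2) / ‖v‖ ^ 2 =
      Real.circleAverage (fun z => ‖u z‖ ^ 2) c r / (2 * ‖v‖ ^ 2) +
        10 * (‖u c‖ ^ 2 / ‖v‖ ^ 2) := by
    field_simp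
  rw [h5]
  linarith

end JensenUpper

/-! ### Multiplicities under composition and truncations of N_φ -/

theorem analyticOrderNatAt_comp_sub {h φ : ℂ → ℂ} {z v : ℂ} (hh : AnalyticAt ℂ h (φ z))
    (hφ : AnalyticAt ℂ φ z) (hv : h (φ z) = v)
    (htop : analyticOrderAt (fun ζ => h (φ ζ) - v) z ≠ ⊤) :
    analyticOrderNatAt (fun ζ => h (φ ζ) - v) z =
      analyticOrderNatAt (fun ζ => h ζ - v) (φ z) * analyticOrderNatAt (fun ζ => φ ζ - φ z) z ∧
    0 < analyticOrderNatAt (fun ζ => h ζ - v) (φ z) := by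
  have ha : AnalyticAt ℂ (fun ζ => h ζ - v) (φ z) := hh.sub analyticAt_const
  have hb : AnalyticAt ℂ (fun ζ => φ ζ - φ z) z := hφ.sub analyticAt_const
  have hc := ha.analyticOrderAt_comp hφ
  change analyticOrderAt (fun ζ => h (φ ζ) - v) z = _ at hc
  have h1 : analyticOrderAt (fun ζ => φ ζ - φ z) z ≠ 0 := by
    rw [Ne, hb.analyticOrderAt_eq_zero]; simp
  have h2 : analyticOrderAt (fun ζ => h ζ - v) (φ z) ≠ 0 := by
    rw [Ne, ha.analyticOrderAt_eq_zero]; simp [hv]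
  refine ⟨by rw [analyticOrderNatAt, hc, ENat.toNat_mul]; rfl, ?_⟩
  refine Nat.pos_of_ne_zero ?_
  rw [analyticOrderNatAt, Ne, ENat.toNat_eq_zero, not_or]
  refine ⟨h2, fun h3 => htop ?_⟩
  rw [hc, h3, ENat.top_mul h1]

/-- A sum in `ENNReal` is the supremum of its finite partial sums, and in each of these log(r/|z|) →
log(1/|z|) as r → 1, because w ≠ φ(0) keeps z away from 0. -/
theorem nevanlinnaCounting_le {φ : ℂ → ℂ} {w : ℂ} (hw : w ≠ φ 0) {X : ℝ}
    (hX : ∀ r ∈ Set.Ioo (0 : ℝ) 1, ∀ S : Finset ℂ, (∀ z ∈ S, z ∈ ball (0 : ℂ) r ∧ φ z = w) →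
      ∑ z ∈ S, (analyticOrderNatAt (fun ζ => φ ζ - w) z : ℝ) * Real.log (r / ‖z‖) ≤ X) :
    nevanlinnaCounting φ w ≤ ENNReal.ofReal X := by
  classical
  rw [nevanlinnaCounting, if_neg hw]
  rw [ENNReal.tsum_eq_iSup_sum]
  refine iSup_le fun s => ?_
  have hlim : Tendsto (fun r : ℝ => ∑ z ∈ s,
      (analyticOrderNatAt (fun ζ => φ ζ - w) (z : ℂ) : ℝ) * Real.log (r / ‖(z : ℂ)‖)) (𝓝[<] 1)
      (𝓝 (∑ z ∈ s, (analyticOrderNatAt (fun ζ => φ ζ - w) (z : ℂ) : ℝ) *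
        Real.log (1 / ‖(z : ℂ)‖))) := by
    refine Tendsto.mono_left ?_ nhdsWithin_le_nhds
    refine tendsto_finsetSum _ fun z _ => Tendsto.const_mul _ ?_
    have hz0 : ‖(z : ℂ)‖ ≠ 0 := by
      rw [norm_ne_zero_iff]
      intro h
      exact hw (by rw [← h]; exact z.2.2.symm)
    exact (((continuous_id.div_const ‖(z : ℂ)‖).tendsto 1).log (one_div_ne_zero hz0))
  have hle := le_of_tendsto hlim (b := X) ?_
  · calc ∑ z ∈ s, (analyticOrderNatAt (fun ζ => φ ζ - w) (z : ℂ) : ENNReal) *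
          ENNReal.ofReal (Real.log (1 / ‖(z : ℂ)‖))
        = ENNReal.ofReal (∑ z ∈ s, (analyticOrderNatAt (fun ζ => φ ζ - w) (z : ℂ) : ℝ) *
          Real.log (1 / ‖(z : ℂ)‖)) := by
          have hlog : ∀ z ∈ s, 0 ≤ Real.log (1 / ‖(z : ℂ)‖) := by
            intro z _
            rw [one_div, Real.log_inv, neg_nonneg]
            exact Real.log_nonpos (norm_nonneg _) (mem_ball_zero_iff.1 z.2.1).le
          rw [ENNReal.ofReal_sum_of_nonneg fun z hz => mul_nonneg (Nat.cast_nonneg _) (hlog z hz)]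
          refine Finset.sum_congr rfl fun z hz => ?_
          rw [ENNReal.ofReal_mul (Nat.cast_nonneg _), ENNReal.ofReal_natCast]
      _ ≤ ENNReal.ofReal X := ENNReal.ofReal_le_ofReal hle
  · have hr : ∀ᶠ r : ℝ in 𝓝[<] 1, ∀ z ∈ s, ‖(z : ℂ)‖ < r := by
      rw [Filter.eventually_all_finset]
      intro z _
      filter_upwards [Ioo_mem_nhdsLT (mem_ball_zero_iff.1 z.2.1)] with r hr using hr.1
    filter_upwards [hr, Ioo_mem_nhdsLT (zero_lt_one' ℝ)] with r hr hr01
    have := hX r hr01 (s.map (Function.Embedding.subtype _)) ?_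
    · simpa using this
    · intro z hz
      obtain ⟨z', hz', rfl⟩ := Finset.mem_map.1 hz
      exact ⟨mem_ball_zero_iff.2 (hr z' hz'), z'.2.2⟩

/-! ### Szegő kernels as test functions -/

namespace HardySpace

/-- The Szegő kernels. -/
theorem exists_szegoKernel {a : ℂ} (ha : a ∈ ball (0 : ℂ) 1) :
    ∃ k : HardySpace, Set.EqOn k (fun z => (-(starRingEnd ℂ a) * z + 1)⁻¹) (ball 0 1) ∧
      ‖k‖ ^ 2 = (1 - ‖a‖ ^ 2)⁻¹ := by
  have ha' := mem_ball_zero_iff.1 ha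
  have hg : HasSum (fun k : ℕ => ‖(starRingEnd ℂ a) ^ k‖ ^ 2) (1 - ‖a‖ ^ 2)⁻¹ := by
    have := hasSum_geometric_of_lt_one (sq_nonneg ‖a‖)
      (pow_lt_one₀ (norm_nonneg a) ha' two_ne_zero)
    simpa [← pow_mul, mul_comm] using this
  obtain ⟨k, hk⟩ := exists_taylorCoeff_eq hg.summable
  refine ⟨k, fun z hz => ?_, ?_⟩
  · have h1 := hasSum_taylorCoeff k.differentiableOn hz
    simp only [hk, ← mul_pow] at h1
    have h2 : ‖starRingEnd ℂ a * z‖ < 1 := by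
      rw [norm_mul, RCLike.norm_conj]
      exact mul_lt_one_of_nonneg_of_lt_one_left (norm_nonneg _) ha' (mem_ball_zero_iff.1 hz).le
    rw [h1.unique (hasSum_geometric_of_norm_lt_one h2)]
    congr 1; ring
  · rw [norm_sq_eq_tsum]
    simp only [hk]
    exact hg.tsum_eq

/-- The Szegő kernel `(1 - conj a * z)⁻¹` at a point `a` of the disk. -/
noncomputable def szegoKernel (a : ℂ) : HardySpace :=
  open Classical in if ha : a ∈ ball (0 : ℂ) 1 then (exists_szegoKernel ha).choose else 0

theorem szegoKernel_eqOn {a : ℂ} (ha : a ∈ ball (0 : ℂ) 1) :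
    Set.EqOn (szegoKernel a) (fun z => (-(starRingEnd ℂ a) * z + 1)⁻¹) (ball 0 1) := by
  rw [szegoKernel, dif_pos ha]; exact (exists_szegoKernel ha).choose_spec.1

theorem norm_szegoKernel_sq {a : ℂ} (ha : a ∈ ball (0 : ℂ) 1) :
    ‖szegoKernel a‖ ^ 2 = (1 - ‖a‖ ^ 2)⁻¹ := by
  rw [szegoKernel, dif_pos ha]; exact (exists_szegoKernel ha).choose_spec.2

theorem iteratedDeriv_szegoKernel {a z : ℂ} (ha : a ∈ ball (0 : ℂ) 1) (hz : z ∈ ball (0 : ℂ) 1)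
    (n : ℕ) : iteratedDeriv n (szegoKernel a) z =
      n.factorial * (starRingEnd ℂ a) ^ n / (1 - starRingEnd ℂ a * z) ^ (n + 1) := by
  have h : (szegoKernel a : ℂ → ℂ) =ᶠ[𝓝 z] fun z => (-(starRingEnd ℂ a) * z + 1)⁻¹ :=
    (szegoKernel_eqOn ha).eventuallyEq_of_mem (isOpen_ball.mem_nhds hz)
  rw [h.iteratedDeriv_eq, iteratedDeriv_eq_iterate, iter_deriv_inv_linear]
  have h1 : (-(starRingEnd ℂ a) * z + 1) ^ (-1 - (n : ℤ)) =
      ((1 - starRingEnd ℂ a * z) ^ (n + 1))⁻¹ := by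
    rw [show (-1 - (n : ℤ)) = -((n + 1 : ℕ) : ℤ) by push_cast; ring, zpow_neg, zpow_natCast]
    congr 2; ring
  simp only [h1]
  rw [neg_pow (starRingEnd ℂ a) n, div_eq_mul_inv]
  -- One sign (-1)ⁿ comes from differentiating the inverse n times, the other from the inner
  -- coefficient -conj a.
  have h2 : ((-1 : ℂ) ^ n) * (-1) ^ n = 1 := by rw [← mul_pow]; simp
  linear_combination (n.factorial * (starRingEnd ℂ a) ^ n *
    ((1 - starRingEnd ℂ a * z) ^ (n + 1))⁻¹) * h2

/-- The bound is uniform in a for fixed z, so the normalizing factor √(1 - |a|²) alone forces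
pointwise convergence to 0. -/
theorem norm_iteratedDeriv_szegoKernel_le {a z : ℂ} (ha : a ∈ ball (0 : ℂ) 1)
    (hz : z ∈ ball (0 : ℂ) 1) (n : ℕ) :
    ‖iteratedDeriv n (szegoKernel a) z‖ ≤ n.factorial / (1 - ‖z‖) ^ (n + 1) := by
  have ha' := mem_ball_zero_iff.1 ha
  have hz' := mem_ball_zero_iff.1 hz
  rw [iteratedDeriv_szegoKernel ha hz, norm_div, norm_mul, norm_pow, norm_pow, Complex.norm_natCast,
    RCLike.norm_conj]
  have h1 : 1 - ‖z‖ ≤ ‖1 - starRingEnd ℂ a * z‖ := by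
    have := norm_sub_norm_le (1 : ℂ) (starRingEnd ℂ a * z)
    rw [norm_one, norm_mul, RCLike.norm_conj] at this
    nlinarith [norm_nonneg z]
  have h2 : 0 < 1 - ‖z‖ := by linarith
  gcongr
  exact mul_le_of_le_one_right (Nat.cast_nonneg _) (pow_le_one₀ (norm_nonneg _) ha'.le)

theorem norm_iteratedDeriv_szegoKernel_self {a : ℂ} (ha : a ∈ ball (0 : ℂ) 1) (n : ℕ) :
    ‖iteratedDeriv n (szegoKernel a) a‖ =
      n.factorial * ‖a‖ ^ n / (1 - ‖a‖ ^ 2) ^ (n + 1) := by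
  have ha' := mem_ball_zero_iff.1 ha
  rw [iteratedDeriv_szegoKernel ha ha, norm_div, norm_mul, norm_pow, norm_pow,
    Complex.norm_natCast, RCLike.norm_conj]
  congr 2
  rw [mul_comm, Complex.mul_conj, Complex.normSq_eq_norm_sq, ← Complex.ofReal_one,
    ← Complex.ofReal_sub, Complex.norm_real, Real.norm_eq_abs, abs_of_nonneg]
  nlinarith [norm_nonneg a]

/-- A compact operator of the form `f ↦ f⁽ⁿ⁾ ∘ φ` maps the normalized Szegő kernels to functions
tending to zero. -/
theorem tendsto_compDeriv_szegoKernel {φ : ℂ → ℂ} (hmaps : Set.MapsTo φ (ball 0 1) (ball 0 1))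
    {n : ℕ} {T : HardySpace →L[ℂ] HardySpace}
    (hT : ∀ f : HardySpace, ∀ z ∈ ball (0 : ℂ) 1, T f z = iteratedDeriv n f (φ z))
    (hc : IsCompactOperator T) :
    Tendsto (fun a : ℂ => T ((√(1 - ‖a‖ ^ 2) : ℂ) • szegoKernel a)) (comap norm (𝓝[<] (1 : ℝ)))
      (𝓝 0) := by
  have hev : ∀ᶠ a : ℂ in comap norm (𝓝[<] (1 : ℝ)), a ∈ ball (0 : ℂ) 1 := by
    have : ∀ᶠ r : ℝ in 𝓝[<] 1, r < 1 := eventually_mem_nhdsWithin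
    filter_upwards [this.comap norm] with a ha using mem_ball_zero_iff.2 ha
  -- The images of unit vectors stay in a compact set, so it suffices that every cluster point is 0;
  -- this follows from pointwise convergence and continuity of evaluations.
  refine (hc.isCompact_closure_image_closedBall 1).tendsto_nhds_of_unique_mapClusterPt ?_ ?_
  · filter_upwards [hev] with a ha
    refine subset_closure ⟨_, ?_, rfl⟩
    have ha' := mem_ball_zero_iff.1 ha
    have h1 : 0 < 1 - ‖a‖ ^ 2 := by nlinarith [norm_nonneg a]
    rw [mem_closedBall_zero_iff, ← sq_le_one_iff₀ (norm_nonneg _), norm_smul, mul_pow,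
      norm_szegoKernel_sq ha, Complex.norm_real, Real.norm_eq_abs, sq_abs, Real.sq_sqrt h1.le,
      mul_inv_cancel₀ h1.ne']
  · intro g _ hg
    refine eq_zero_of_forall_apply fun z hz => ?_
    have hcl := hg.continuousAt_comp (continuous_apply hz).continuousAt
    have hw := mem_ball_zero_iff.1 (hmaps hz)
    have htend : Tendsto (fun a : ℂ => (T ((√(1 - ‖a‖ ^ 2) : ℂ) • szegoKernel a)) z)
        (comap norm (𝓝[<] (1 : ℝ))) (𝓝 0) := by
      have h0 : Tendsto (fun r : ℝ => √(1 - r ^ 2) *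
          (n.factorial / (1 - ‖φ z‖) ^ (n + 1))) (𝓝[<] 1) (𝓝 0) := by
        have : Tendsto (fun r : ℝ => √(1 - r ^ 2) *
          (n.factorial / (1 - ‖φ z‖) ^ (n + 1))) (𝓝 1) (𝓝 (√(1 - 1 ^ 2) *
          (n.factorial / (1 - ‖φ z‖) ^ (n + 1)))) := Continuous.tendsto (by fun_prop) 1
        simp only [one_pow, sub_self, Real.sqrt_zero, zero_mul] at this
        exact this.mono_left nhdsWithin_le_nhds
      refine squeeze_zero_norm' ?_ (h0.comp tendsto_comap)
      filter_upwards [hev] with a ha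
      rw [hT _ z hz, iteratedDeriv_smul, norm_mul, Complex.norm_real, Real.norm_eq_abs,
        abs_of_nonneg (Real.sqrt_nonneg _)]
      exact mul_le_mul_of_nonneg_left (norm_iteratedDeriv_szegoKernel_le ha (hmaps hz) n)
        (Real.sqrt_nonneg _)
    have : (𝓝 (g z) ⊓ 𝓝 0).NeBot := hcl.neBot.mono (inf_le_inf le_rfl htend)
    exact eq_of_nhds_neBot this

end HardySpace

/-! ### Necessity -/

open HardySpace in
-- Every z with φ(z) = a is a zero of h ∘ φ - h(a) of at least the same multiplicity, where h is the
-- n-th derivative of the kernel. The quadratic bound then applies, with circle means and |h(φ(0))|²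
-- both at most ‖g‖²; 11 rounds up 1/2 + 10.
theorem nevanlinnaCounting_le_of_szegoKernel {φ : ℂ → ℂ} (hφ : DifferentiableOn ℂ φ (ball 0 1))
    (hmaps : Set.MapsTo φ (ball 0 1) (ball 0 1)) {n : ℕ} {g : HardySpace} {a : ℂ}
    (ha : a ∈ ball (0 : ℂ) 1) (haφ : a ≠ φ 0) (ha0 : a ≠ 0)
    (hg : ∀ z ∈ ball (0 : ℂ) 1, g z = iteratedDeriv n (szegoKernel a) (φ z))
    (hsmall : ‖g‖ ≤ ‖iteratedDeriv n (szegoKernel a) a‖ / 2) :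
    nevanlinnaCounting φ a ≤
      ENNReal.ofReal (11 * ‖g‖ ^ 2 / ‖iteratedDeriv n (szegoKernel a) a‖ ^ 2) := by
  set h := iteratedDeriv n (szegoKernel a) with hh
  have hhd : DifferentiableOn ℂ h (ball 0 1) :=
    differentiableOn_iteratedDeriv isOpen_ball (szegoKernel a).differentiableOn n
  have ha' := mem_ball_zero_iff.1 ha
  have hv0 : 0 < ‖h a‖ := by
    rw [hh, norm_iteratedDeriv_szegoKernel_self ha]
    have h1 : 0 < 1 - ‖a‖ ^ 2 := by nlinarith [norm_nonneg a]
    have h2 : 0 < ‖a‖ := norm_pos_iff.2 ha0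
    positivity
  have hud : DifferentiableOn ℂ (fun z => h (φ z)) (ball 0 1) := hhd.comp hφ hmaps
  have hmean : ∀ r ∈ Set.Ico (0 : ℝ) 1, hardyMean (fun z => h (φ z)) r ≤ ‖g‖ ^ 2 := fun r hr =>
    (hardyMean_congr (fun z hz => (hg z hz).symm) hr).trans_le (g.hardyMean_le hr)
  have h0 : ‖h (φ 0)‖ ≤ ‖g‖ := by
    have := hmean 0 ⟨le_rfl, zero_lt_one⟩
    rw [hardyMean, Real.circleAverage_zero] at this
    exact (sq_le_sq₀ (norm_nonneg _) (norm_nonneg _)).1 this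
  refine nevanlinnaCounting_le haφ fun r hr S hS => ?_
  have hsub : closedBall (0 : ℂ) r ⊆ ball 0 1 := closedBall_subset_ball hr.2
  have hu : AnalyticOnNhd ℂ (fun z => h (φ z)) (closedBall 0 r) :=
    (hud.analyticOnNhd isOpen_ball).mono hsub
  have hne : h a ≠ h (φ 0) := by
    intro h1
    rw [h1] at hsmall hv0
    linarith
  have h1 := sum_mul_log_le_jensenDefect hu hr.1 hne S
    (fun z => analyticOrderNatAt (fun ζ => φ ζ - a) z) (fun z hz => (hS z hz).1) ?_
  · simp only [sub_zero] at h1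
    refine h1.trans ((jensenDefect_le hu hr.1 (norm_pos_iff.1 hv0) (h0.trans hsmall)).trans ?_)
    have h2 := hmean r ⟨hr.1.le, hr.2⟩
    rw [hardyMean] at h2
    have h3 : ‖h (φ 0)‖ ^ 2 ≤ ‖g‖ ^ 2 := by gcongr
    have h4 : 0 ≤ ‖g‖ ^ 2 := sq_nonneg _
    gcongr
    linarith
  · intro z hz
    obtain ⟨hz1, hz2⟩ := hS z hz
    have hzb : z ∈ ball (0 : ℂ) 1 := hsub (ball_subset_closedBall hz1)
    obtain ⟨h2, h3⟩ := analyticOrderNatAt_comp_sub (v := h a)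
      (hhd.analyticAt (isOpen_ball.mem_nhds (hmaps hzb)))
      (hφ.analyticAt (isOpen_ball.mem_nhds hzb)) (by rw [hz2])
      (analyticOrderAt_sub_ne_top hu hr.1 hne (ball_subset_closedBall hz1))
    rw [h2, hz2] at *
    exact Nat.le_mul_of_pos_left _ h3

open HardySpace in
theorem nevanlinnaCounting_isLittleO_of_isCompactCompDeriv {φ : ℂ → ℂ}
    (hφ : DifferentiableOn ℂ φ (ball 0 1)) (hmaps : Set.MapsTo φ (ball 0 1) (ball 0 1)) {n : ℕ}
    (hcomp : IsCompactCompDeriv φ n) {ε : ℝ} (hε : 0 < ε) :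
    ∃ R : ℝ, 0 < R ∧ R < 1 ∧ ∀ w : ℂ, R < ‖w‖ → ‖w‖ < 1 →
      nevanlinnaCounting φ w ≤ ENNReal.ofReal (ε * Real.log (1 / ‖w‖) ^ (2 * n + 1)) := by
  obtain ⟨T, hT, hc⟩ := hcomp
  have ht := tendsto_compDeriv_szegoKernel hmaps hT hc
  -- The first entry secures ‖g‖ ≤ v/2, the second the final ε. The power of 1/4 comes from |a| >
  -- 1/2, the power of 2 from 1 - |a|² ≤ 2 log(1/|a|), and 11 from the preceding bound.
  set η := min ((1 / 4 : ℝ) ^ n / 4) (ε * (1 / 4) ^ n / (11 * 2 ^ (2 * n + 1))) with hη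
  have hη0 : 0 < η := by positivity
  have hsq : ∀ᶠ a : ℂ in comap norm (𝓝[<] (1 : ℝ)),
      ‖T ((√(1 - ‖a‖ ^ 2) : ℂ) • szegoKernel a)‖ ^ 2 < η := by
    have := (ht.norm.pow 2)
    simp only [norm_zero, ne_eq, OfNat.ofNat_ne_zero, not_false_eq_true, zero_pow] at this
    exact this.eventually_lt_const hη0
  obtain ⟨t, ht1, ht2⟩ := mem_comap.1 hsq
  obtain ⟨R₀, hR₀, hR₀'⟩ := (mem_nhdsLT_iff_exists_Ioo_subset).1 ht1
  have hR₀1 : R₀ < 1 := hR₀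
  have hφ0 : ‖φ 0‖ < 1 := mem_ball_zero_iff.1 (hmaps (by simp))
  -- Beyond |φ(0)| the infinite value of N_φ at φ(0) is excluded.
  refine ⟨max (max R₀ (1 / 2)) ‖φ 0‖, lt_max_of_lt_left (lt_max_of_lt_right (by norm_num)),
    max_lt (max_lt hR₀1 (by norm_num)) hφ0, fun a haR ha1 => ?_⟩
  obtain ⟨haR, haφ⟩ := max_lt_iff.1 haR
  obtain ⟨haR, ha2⟩ := max_lt_iff.1 haR
  have ha : a ∈ ball (0 : ℂ) 1 := mem_ball_zero_iff.2 ha1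
  have hlt : ‖T ((√(1 - ‖a‖ ^ 2) : ℂ) • szegoKernel a)‖ ^ 2 < η :=
    ht2 (show ‖a‖ ∈ t from hR₀' ⟨haR, ha1⟩)
  set q := 1 - ‖a‖ ^ 2 with hq
  have hq0 : 0 < q := by nlinarith [norm_nonneg a]
  have hq1 : q ≤ 1 := by nlinarith [norm_nonneg a]
  rw [map_smul, norm_smul, mul_pow, Complex.norm_real, Real.norm_eq_abs, sq_abs,
    Real.sq_sqrt hq0.le] at hlt
  set g := T (szegoKernel a) with hgdef
  set v := ‖iteratedDeriv n (szegoKernel a) a‖ with hv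
  have hvle : (1 / 4 : ℝ) ^ n ≤ v ^ 2 * q ^ (2 * n + 2) := by
    have h1 : v * q ^ (n + 1) = n.factorial * ‖a‖ ^ n := by
      rw [hv, norm_iteratedDeriv_szegoKernel_self ha, div_mul_cancel₀]
      positivity
    have h2 : (1 / 2 : ℝ) ^ n ≤ v * q ^ (n + 1) := by
      rw [h1]
      calc (1 / 2 : ℝ) ^ n ≤ 1 * ‖a‖ ^ n := by rw [one_mul]; gcongr
        _ ≤ n.factorial * ‖a‖ ^ n := by
          gcongr; exact_mod_cast n.factorial_pos
    calc (1 / 4 : ℝ) ^ n = ((1 / 2 : ℝ) ^ n) ^ 2 := by rw [← pow_mul, mul_comm, pow_mul]; norm_num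
      _ ≤ (v * q ^ (n + 1)) ^ 2 := by gcongr
      _ = _ := by ring
  have hv0 : 0 < v ^ 2 := by
    have h3 : 0 < v ^ 2 * q ^ (2 * n + 2) := lt_of_lt_of_le (by positivity) hvle
    exact pos_of_mul_pos_left h3 (by positivity)
  have hqq : q ^ (2 * n + 2) ≤ q := pow_le_of_le_one hq0.le hq1 (by omega)
  have hsmall : ‖g‖ ≤ v / 2 := by
    refine (sq_le_sq₀ (norm_nonneg _) (by positivity)).1 ?_
    have h1 : q * ‖g‖ ^ 2 ≤ q * (v / 2) ^ 2 :=
      calc q * ‖g‖ ^ 2 ≤ (1 / 4 : ℝ) ^ n / 4 := hlt.le.trans (min_le_left _ _)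
        _ ≤ v ^ 2 * q ^ (2 * n + 2) / 4 := by gcongr
        _ ≤ v ^ 2 * q / 4 := by gcongr
        _ = _ := by ring
    exact le_of_mul_le_mul_left h1 hq0
  refine (nevanlinnaCounting_le_of_szegoKernel hφ hmaps ha (by rintro rfl; exact lt_irrefl _ haφ)
    (by rintro rfl; norm_num at ha2) (hT (szegoKernel a)) hsmall).trans
    (ENNReal.ofReal_le_ofReal ?_)
  have hlog : q ≤ 2 * Real.log (1 / ‖a‖) := by
    have h1 : 0 < ‖a‖ ^ 2 := by positivity
    have h2 := Real.log_le_sub_one_of_pos h1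
    rw [Real.log_pow] at h2
    push_cast at h2
    rw [one_div, Real.log_inv]
    linarith
  rw [div_le_iff₀ hv0]
  have h1 : q * ‖g‖ ^ 2 ≤ ε * (1 / 4) ^ n / (11 * 2 ^ (2 * n + 1)) :=
    hlt.le.trans (min_le_right _ _)
  refine le_of_mul_le_mul_left ?_ hq0
  calc q * (11 * ‖g‖ ^ 2) = 11 * (q * ‖g‖ ^ 2) := by ring
    _ ≤ 11 * (ε * (1 / 4) ^ n / (11 * 2 ^ (2 * n + 1))) := by gcongr
    _ = ε / 2 ^ (2 * n + 1) * (1 / 4) ^ n := by field_simp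
    _ ≤ ε / 2 ^ (2 * n + 1) * (v ^ 2 * q ^ (2 * n + 2)) := by gcongr
    _ = q * (ε * (q / 2) ^ (2 * n + 1) * v ^ 2) := by rw [div_pow]; field_simp; ring
    _ ≤ q * (ε * Real.log (1 / ‖a‖) ^ (2 * n + 1) * v ^ 2) := by
      gcongr; linarith

/-! ### Sufficiency: powers of the logarithm as superpositions of Jensen kernels -/

/-- A Beta integral: `ENNReal.ofReal` takes the positive part, so this writes t^(p+2) as a
superposition of the kernels (t - s)⁺. -/
theorem lintegral_Ioi_pow_mul_sub (p : ℕ) {t : ℝ} (ht : 0 ≤ t) :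
    ∫⁻ s in Set.Ioi (0 : ℝ), ENNReal.ofReal (s ^ p) * ENNReal.ofReal (t - s) =
      ENNReal.ofReal (t ^ (p + 2) / ((p + 1) * (p + 2))) := by
  have h1 : ∀ s ∈ Set.Ioi (0 : ℝ), ENNReal.ofReal (s ^ p) * ENNReal.ofReal (t - s) =
      (Set.Ioc 0 t).indicator (fun s => ENNReal.ofReal (s ^ p * (t - s))) s := by
    intro s hs
    have hs : 0 < s := hs
    rw [← ENNReal.ofReal_mul (by positivity)]
    by_cases hst : s ≤ t
    · rw [Set.indicator_of_mem (show s ∈ Set.Ioc 0 t from ⟨hs, hst⟩)]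
    · rw [Set.indicator_of_notMem (by simp [hst])]
      exact ENNReal.ofReal_of_nonpos (mul_nonpos_of_nonneg_of_nonpos (by positivity) (by linarith))
  have hint : ∫ s in (0 : ℝ)..t, s ^ p * (t - s) = t ^ (p + 2) / ((p + 1) * (p + 2)) := by
    have : ∀ s : ℝ, s ^ p * (t - s) = t * s ^ p - s ^ (p + 1) := fun s => by ring
    simp only [this]
    rw [intervalIntegral.integral_sub (Continuous.intervalIntegrable (by fun_prop) _ _)
      (Continuous.intervalIntegrable (by fun_prop) _ _),
      intervalIntegral.integral_const_mul, integral_pow, integral_pow]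
    push_cast
    field_simp
    ring
  rw [setLIntegral_congr_fun measurableSet_Ioi h1, lintegral_indicator measurableSet_Ioc,
    Measure.restrict_restrict measurableSet_Ioc, Set.inter_eq_left.2 (fun s hs => hs.1),
    ← ofReal_integral_eq_lintegral_ofReal, ← intervalIntegral.integral_of_le ht, hint]
  · exact (by fun_prop : Continuous fun s : ℝ => s ^ p * (t - s)).integrableOn_Ioc
  · refine (ae_restrict_iff' measurableSet_Ioc).2 (ae_of_all _ fun s hs => ?_)
    exact mul_nonneg (pow_nonneg hs.1.le _) (sub_nonneg.2 hs.2)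

theorem lintegral_Ioi_pow_mul_exp (p : ℕ) {c : ℝ} (hc : 0 < c) :
    ∫⁻ s in Set.Ioi (0 : ℝ), ENNReal.ofReal (s ^ p) * ENNReal.ofReal (Real.exp (-(c * s))) =
      ENNReal.ofReal (p.factorial / c ^ (p + 1)) := by
  have h := Real.integral_rpow_mul_exp_neg_mul_Ioi (a := p + 1) (by positivity) hc
  simp only [add_sub_cancel_right, Real.rpow_natCast, Real.Gamma_nat_eq_factorial] at h
  have h2 : (1 / c) ^ ((p : ℝ) + 1) * (p.factorial : ℝ) = p.factorial / c ^ (p + 1) := by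
    rw [← Nat.cast_add_one, Real.rpow_natCast, one_div, inv_pow]
    field_simp
  rw [h2] at h
  -- A non-integrable function would have integral 0 by convention, against the positive value just
  -- computed.
  have hint : IntegrableOn (fun s : ℝ => s ^ p * Real.exp (-(c * s))) (Set.Ioi 0) := by
    by_contra hn
    rw [integral_undef hn] at h
    have : 0 < (p.factorial : ℝ) / c ^ (p + 1) := by
      have : (0 : ℝ) < p.factorial := by exact_mod_cast p.factorial_pos
      positivity
    linarith
  rw [← h, ofReal_integral_eq_lintegral_ofReal hint]
  · refine setLIntegral_congr_fun measurableSet_Ioi fun s hs => ?_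
    rw [ENNReal.ofReal_mul (pow_nonneg (Set.mem_Ioi.1 hs).le _)]
  · refine (ae_restrict_iff' measurableSet_Ioi).2 (ae_of_all _ fun s hs => ?_)
    have : 0 < s := hs
    positivity

theorem ofReal_sum_le_nevanlinnaCounting {φ : ℂ → ℂ} {w : ℂ} (hw : w ≠ φ 0) {r : ℝ}
    (hr : r ∈ Set.Ioo (0 : ℝ) 1) (S : Finset ℂ) (hS : ∀ z ∈ S, z ∈ ball (0 : ℂ) r ∧ φ z = w) :
    ENNReal.ofReal (∑ z ∈ S,
      (analyticOrderNatAt (fun ζ => φ ζ - w) z : ℝ) * Real.log (r / ‖z‖)) ≤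
      nevanlinnaCounting φ w := by
  classical
  rw [nevanlinnaCounting, if_neg hw]
  have hz0 : ∀ z ∈ S, 0 < ‖z‖ := by
    intro z hz
    rw [norm_pos_iff]
    rintro rfl
    exact hw (hS 0 hz).2.symm
  have hle : ENNReal.ofReal (∑ z ∈ S,
      (analyticOrderNatAt (fun ζ => φ ζ - w) z : ℝ) * Real.log (r / ‖z‖)) ≤
      ∑ z ∈ S, (analyticOrderNatAt (fun ζ => φ ζ - w) z : ENNReal) *
        ENNReal.ofReal (Real.log (1 / ‖z‖)) := by
    rw [ENNReal.ofReal_sum_of_nonneg]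
    · refine Finset.sum_le_sum fun z hz => ?_
      rw [ENNReal.ofReal_mul (Nat.cast_nonneg _), ENNReal.ofReal_natCast]
      have := hz0 z hz
      have := hr.1
      have := hr.2.le
      gcongr
    · intro z hz
      refine mul_nonneg (Nat.cast_nonneg _) (Real.log_nonneg ?_)
      rw [one_le_div (hz0 z hz)]
      exact (mem_ball_zero_iff.1 (hS z hz).1).le
  refine hle.trans ?_
  have hsub : ∀ z ∈ S, z ∈ ball (0 : ℂ) 1 ∧ φ z = w := fun z hz =>
    ⟨ball_subset_ball hr.2.le (hS z hz).1, (hS z hz).2⟩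
  rw [← Finset.sum_subtype_of_mem (fun z => (analyticOrderNatAt (fun ζ => φ ζ - w) z : ENNReal) *
        ENNReal.ofReal (Real.log (1 / ‖z‖))) hsub]
  exact ENNReal.sum_le_tsum _

/-- With t = log(1/|w|), the kernel (t - s)⁺ equals log⁺(e^(-s)/|w|). For each s the sum over W is
thus part of Jensen's sum for h on the disk of radius e^(-s). -/
theorem ofReal_sum_mul_log_pow_le {h : ℂ → ℂ} (hh : DifferentiableOn ℂ h (ball 0 1)) {v : ℂ}
    (hv : v ≠ h 0) (p : ℕ) (W : Finset ℂ) (hW : ∀ w ∈ W, w ∈ ball (0 : ℂ) 1 ∧ h w = v) :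
    ENNReal.ofReal (∑ w ∈ W,
      (analyticOrderNatAt (fun ζ => h ζ - v) w : ℝ) * Real.log (1 / ‖w‖) ^ (p + 2)) ≤
    ENNReal.ofReal ((p + 1) * (p + 2)) * ∫⁻ s in Set.Ioi (0 : ℝ),
      ENNReal.ofReal (s ^ p) * ENNReal.ofReal (jensenDefect h 0 (Real.exp (-s)) v) := by
  set m : ℂ → ℕ := fun w => analyticOrderNatAt (fun ζ => h ζ - v) w with hm
  have hw0 : ∀ w ∈ W, 0 < ‖w‖ := by
    intro w hw
    rw [norm_pos_iff]
    rintro rfl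
    exact hv (hW 0 hw).2.symm
  have ht : ∀ w ∈ W, 0 ≤ Real.log (1 / ‖w‖) := by
    intro w hw
    refine Real.log_nonneg ?_
    rw [one_le_div (hw0 w hw)]
    exact (mem_ball_zero_iff.1 (hW w hw).1).le
  have hp : (0 : ℝ) < (p + 1) * (p + 2) := by positivity
  have h1 : ENNReal.ofReal (∑ w ∈ W, (m w : ℝ) * Real.log (1 / ‖w‖) ^ (p + 2)) =
      ENNReal.ofReal ((p + 1) * (p + 2)) * ∫⁻ s in Set.Ioi (0 : ℝ),
        ∑ w ∈ W, (m w : ENNReal) *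
          (ENNReal.ofReal (s ^ p) * ENNReal.ofReal (Real.log (1 / ‖w‖) - s)) := by
    rw [lintegral_finsetSum _ (fun w _ => by fun_prop), Finset.mul_sum,
      ENNReal.ofReal_sum_of_nonneg (fun w hw => mul_nonneg (Nat.cast_nonneg _)
        (pow_nonneg (ht w hw) _))]
    refine Finset.sum_congr rfl fun w hw => ?_
    rw [lintegral_const_mul _ (by fun_prop), lintegral_Ioi_pow_mul_sub p (ht w hw),
      mul_left_comm, ← ENNReal.ofReal_mul hp.le, mul_div_cancel₀ _ hp.ne',
      ENNReal.ofReal_mul (Nat.cast_nonneg _), ENNReal.ofReal_natCast]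
  rw [h1]
  gcongr ENNReal.ofReal ((p + 1) * (p + 2)) * ?_
  refine setLIntegral_mono' measurableSet_Ioi fun s hs => ?_
  have hs : 0 < s := hs
  have he1 : Real.exp (-s) < 1 := by rw [Real.exp_lt_one_iff]; linarith
  have hu : AnalyticOnNhd ℂ h (closedBall 0 (Real.exp (-s))) :=
    (hh.analyticOnNhd isOpen_ball).mono (closedBall_subset_ball he1)
  classical
  have hlog : ∀ w ∈ W, Real.log (Real.exp (-s) / ‖w‖) = Real.log (1 / ‖w‖) - s := by
    intro w hw
    rw [Real.log_div (Real.exp_pos _).ne' (hw0 w hw).ne', Real.log_exp, one_div, Real.log_inv]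
    ring
  have hJ := sum_mul_log_le_jensenDefect hu (Real.exp_pos _) hv
    (W.filter (· ∈ ball (0 : ℂ) (Real.exp (-s)))) m (fun z hz => (Finset.mem_filter.1 hz).2)
    (fun z _ => le_rfl)
  calc ∑ w ∈ W, (m w : ENNReal) *
          (ENNReal.ofReal (s ^ p) * ENNReal.ofReal (Real.log (1 / ‖w‖) - s))
      = ENNReal.ofReal (s ^ p) * ∑ w ∈ W, (m w : ENNReal) *
          ENNReal.ofReal (Real.log (1 / ‖w‖) - s) := by
        rw [Finset.mul_sum]
        exact Finset.sum_congr rfl fun w _ => by ring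
    _ = ENNReal.ofReal (s ^ p) * ∑ w ∈ W.filter (· ∈ ball (0 : ℂ) (Real.exp (-s))),
          (m w : ENNReal) * ENNReal.ofReal (Real.log (1 / ‖w‖) - s) := by
        rw [Finset.sum_filter]
        congr 1
        refine Finset.sum_congr rfl fun w hw => ?_
        split_ifs with hwb
        · rfl
        · rw [mem_ball_zero_iff, not_lt] at hwb
          rw [← hlog w hw, ENNReal.ofReal_of_nonpos, mul_zero]
          refine Real.log_nonpos (by positivity) ?_
          rwa [div_le_one (hw0 w hw)]
    _ = ENNReal.ofReal (s ^ p) * ENNReal.ofReal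
          (∑ w ∈ W.filter (· ∈ ball (0 : ℂ) (Real.exp (-s))),
            (m w : ℝ) * Real.log (Real.exp (-s) / ‖w - 0‖)) := by
        rw [ENNReal.ofReal_sum_of_nonneg]
        · congr 1
          refine Finset.sum_congr rfl fun w hw => ?_
          rw [ENNReal.ofReal_mul (Nat.cast_nonneg _), ENNReal.ofReal_natCast, sub_zero,
            hlog w (Finset.mem_filter.1 hw).1]
        · intro w hw
          obtain ⟨hw1, hw2⟩ := Finset.mem_filter.1 hw
          refine mul_nonneg (Nat.cast_nonneg _) (Real.log_nonneg ?_)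
          rw [sub_zero, one_le_div (hw0 w hw1)]
          exact (mem_ball_zero_iff.1 hw2).le
    _ ≤ _ := by gcongr

theorem lintegral_lintegral_pow_mul_jensenDefect {h : ℂ → ℂ}
    (hh : DifferentiableOn ℂ h (ball 0 1)) (p : ℕ) :
    ∫⁻ v, ∫⁻ s in Set.Ioi (0 : ℝ),
      ENNReal.ofReal (s ^ p) * ENNReal.ofReal (jensenDefect h 0 (Real.exp (-s)) v) =
    ∫⁻ s in Set.Ioi (0 : ℝ), ENNReal.ofReal (s ^ p) *
      ENNReal.ofReal (Real.pi / 2 * (hardyMean h (Real.exp (-s)) - ‖h 0‖ ^ 2)) := by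
  classical
  -- Nothing is known of h off the disk; cutting it off there gives a jointly measurable integrand,
  -- unchanged for s > 0.
  set F : ℝ → ℝ → ℂ := fun s θ =>
    (ball (0 : ℂ) 1).indicator h (circleMap 0 (Real.exp (-s)) θ) with hF
  have hFm : Measurable (Function.uncurry F) := by
    have h1 : Measurable ((ball (0 : ℂ) 1).indicator h) := by
      rw [← Set.piecewise_eq_indicator]
      exact hh.continuousOn.measurable_piecewise continuousOn_const measurableSet_ball
    refine h1.comp (Continuous.measurable ?_)
    simp only [circleMap]
    fun_prop
  have hJ : ∀ s ∈ Set.Ioi (0 : ℝ), ∀ v, jensenDefect h 0 (Real.exp (-s)) v =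
      (2 * Real.pi)⁻¹ • (∫ θ in (0 : ℝ)..2 * Real.pi, Real.log ‖F s θ - v‖) -
        Real.log ‖h 0 - v‖ := by
    intro s hs v
    have he1 : Real.exp (-s) < 1 := by rw [Real.exp_lt_one_iff]; linarith [Set.mem_Ioi.1 hs]
    rw [jensenDefect, Real.circleAverage]
    have : ∀ θ, circleMap 0 (Real.exp (-s)) θ ∈ ball (0 : ℂ) 1 := fun θ => by
      simpa [abs_of_pos (Real.exp_pos _)] using he1
    simp only [hF, Set.indicator_of_mem (this _)]
  have hm := measurable_circleAverage_log_norm_sub hFm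
  have hswap : ∀ v, ∫⁻ s in Set.Ioi (0 : ℝ),
      ENNReal.ofReal (s ^ p) * ENNReal.ofReal (jensenDefect h 0 (Real.exp (-s)) v) =
      ∫⁻ s in Set.Ioi (0 : ℝ), ENNReal.ofReal (s ^ p) *
        ENNReal.ofReal ((2 * Real.pi)⁻¹ • (∫ θ in (0 : ℝ)..2 * Real.pi, Real.log ‖F s θ - v‖) -
        Real.log ‖h 0 - v‖) := fun v =>
    setLIntegral_congr_fun measurableSet_Ioi fun s hs => by simp only [hJ s hs v]
  simp only [hswap]
  rw [lintegral_lintegral_swap]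
  · refine setLIntegral_congr_fun measurableSet_Ioi fun s hs => ?_
    have he1 : Real.exp (-s) < 1 := by rw [Real.exp_lt_one_iff]; linarith [Set.mem_Ioi.1 hs]
    have hu : AnalyticOnNhd ℂ h (closedBall 0 (Real.exp (-s))) :=
      (hh.analyticOnNhd isOpen_ball).mono (closedBall_subset_ball he1)
    change _ = ENNReal.ofReal (s ^ p) * ENNReal.ofReal (Real.pi / 2 *
      (Real.circleAverage (fun z => ‖h z‖ ^ 2) 0 (Real.exp (-s)) - ‖h 0‖ ^ 2))
    rw [← lintegral_jensenDefect hu (Real.exp_pos _),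
      ← lintegral_const_mul' _ _ ENNReal.ofReal_ne_top]
    exact lintegral_congr fun v => by rw [hJ s hs v]
  · refine Measurable.aemeasurable ?_
    have h2 := hm.comp
      (measurable_snd.prodMk measurable_fst : Measurable fun q : ℂ × ℝ => (q.2, q.1))
    have h3 : Measurable fun q : ℂ × ℝ => Real.log ‖h 0 - q.1‖ := by fun_prop
    have h4 : Measurable fun q : ℂ × ℝ => ENNReal.ofReal (q.2 ^ p) := by fun_prop
    exact h4.mul (h2.sub h3).ennreal_ofReal

/-- Parseval on the circle of radius e^(-s) gives a series in e^(-2ks) whose constant term cancels;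
the other terms are Gamma integrals. -/
theorem lintegral_pow_mul_hardyMean_sub {h : ℂ → ℂ} (hh : DifferentiableOn ℂ h (ball 0 1)) (p : ℕ) :
    ∫⁻ s in Set.Ioi (0 : ℝ), ENNReal.ofReal (s ^ p) *
      ENNReal.ofReal (hardyMean h (Real.exp (-s)) - ‖h 0‖ ^ 2) =
    ∑' k : ℕ, ENNReal.ofReal (‖taylorCoeff h (k + 1)‖ ^ 2 *
      (p.factorial / (2 * (k + 1)) ^ (p + 1))) := by
  have h1 : ∀ s ∈ Set.Ioi (0 : ℝ), ENNReal.ofReal (s ^ p) *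
      ENNReal.ofReal (hardyMean h (Real.exp (-s)) - ‖h 0‖ ^ 2) =
      ∑' k : ℕ, ENNReal.ofReal (‖taylorCoeff h (k + 1)‖ ^ 2) *
        (ENNReal.ofReal (s ^ p) * ENNReal.ofReal (Real.exp (-(2 * (k + 1) * s)))) := by
    intro s hs
    have he1 : Real.exp (-s) < 1 := by rw [Real.exp_lt_one_iff]; linarith [Set.mem_Ioi.1 hs]
    have hsum : HasSum (fun k => ‖taylorCoeff h k‖ ^ 2 * Real.exp (-s) ^ (2 * k))
      (hardyMean h (Real.exp (-s))) := hasSum_hardyMean hh ⟨(Real.exp_pos _).le, he1⟩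
    have hsum' := (hasSum_nat_add_iff' 1).2 hsum
    have h0 : ‖taylorCoeff h 0‖ ^ 2 = ‖h 0‖ ^ 2 := by simp [taylorCoeff]
    simp only [Finset.range_one, Finset.sum_singleton, mul_zero, pow_zero, mul_one, h0] at hsum'
    rw [← hsum'.tsum_eq, ENNReal.ofReal_tsum_of_nonneg (fun k => by positivity) hsum'.summable,
      ← ENNReal.tsum_mul_left]
    refine tsum_congr fun k => ?_
    rw [ENNReal.ofReal_mul (by positivity), ← Real.exp_nat_mul]
    have : ((2 * (k + 1) : ℕ) : ℝ) * -s = -(2 * (k + 1) * s) := by push_cast; ring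
    rw [this]
    ring
  rw [setLIntegral_congr_fun measurableSet_Ioi h1, lintegral_tsum (fun k => by fun_prop)]
  refine tsum_congr fun k => ?_
  rw [lintegral_const_mul _ (by fun_prop), lintegral_Ioi_pow_mul_exp p (by positivity),
    ← ENNReal.ofReal_mul (by positivity)]

/-- On the circle |φ - w| < 2, so the average of the logarithm is at most log 2. This universal
bound serves where the hypothesis on N_φ says nothing. -/
theorem jensenDefect_le_log {φ : ℂ → ℂ} (hφ : DifferentiableOn ℂ φ (ball 0 1))
    (hmaps : Set.MapsTo φ (ball 0 1) (ball 0 1)) {r : ℝ} (hr : r ∈ Set.Ioo (0 : ℝ) 1) {w : ℂ}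
    (hw : w ∈ ball (0 : ℂ) 1) (hwφ : w ≠ φ 0) :
    jensenDefect φ 0 r w ≤ Real.log (2 / ‖w - φ 0‖) := by
  have hsub : closedBall (0 : ℂ) r ⊆ ball 0 1 := closedBall_subset_ball hr.2
  have hu : AnalyticOnNhd ℂ φ (closedBall 0 r) := (hφ.analyticOnNhd isOpen_ball).mono hsub
  have h1 : Real.circleAverage (fun z => Real.log ‖φ z - w‖) 0 r ≤ Real.log 2 := by
    refine Real.circleAverage_mono_on_of_le_circle (circleIntegrable_log_norm_sub hu hr.1 w) ?_
    intro z hz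
    rw [abs_of_pos hr.1] at hz
    have h2 := mem_ball_zero_iff.1 (hmaps (hsub (sphere_subset_closedBall hz)))
    have h3 := mem_ball_zero_iff.1 hw
    rcases (norm_nonneg (φ z - w)).eq_or_lt with h | h
    · rw [← h, Real.log_zero]; exact Real.log_nonneg one_le_two
    · exact Real.log_le_log h (by linarith [norm_sub_le (φ z) w])
  rw [jensenDefect, norm_sub_rev, Real.log_div two_ne_zero (norm_ne_zero_iff.2 (sub_ne_zero.2 hwφ))]
  linarith

/-- Since log(δ/x) ≥ log 2, the constant log(2/δ) is absorbed. The logarithmic pole at φ(0) is thus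
dominated by the Jensen kernel of the disk about φ(0). -/
theorem log_two_div_le {x δ : ℝ} (hx : 0 < x) (hδ0 : 0 < δ) (hδ1 : δ ≤ 1) (hxδ : x ≤ δ / 2) :
    Real.log (2 / x) ≤ (1 + Real.log (2 / δ) / Real.log 2) * Real.log (δ / x) := by
  have h2 : 0 < Real.log 2 := Real.log_pos one_lt_two
  have h3 : Real.log 2 ≤ Real.log (δ / x) := by
    refine Real.log_le_log two_pos ?_
    rw [le_div_iff₀ hx]; linarith
  have h4 : 0 ≤ Real.log (2 / δ) := Real.log_nonneg (by rw [le_div_iff₀ hδ0]; linarith)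
  have h5 : Real.log (2 / x) = Real.log (2 / δ) + Real.log (δ / x) := by
    rw [← Real.log_mul (by positivity) (by positivity)]
    congr 1; field_simp
  rw [h5, add_mul, one_mul, add_comm]
  gcongr
  calc Real.log (2 / δ) = Real.log (2 / δ) / Real.log 2 * Real.log 2 := by field_simp
    _ ≤ _ := by gcongr

/-- The counting function of `h ∘ φ` is controlled by that of `h`, provided that the counting
function of `φ` is small near the unit circle. -/
theorem ofReal_jensenDefect_comp_le {φ h : ℂ → ℂ} (hφ : DifferentiableOn ℂ φ (ball 0 1))
    (hmaps : Set.MapsTo φ (ball 0 1) (ball 0 1)) (hh : DifferentiableOn ℂ h (ball 0 1)) {p : ℕ}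
    {R ε : ℝ} (hR : 0 < R) (hε : 0 ≤ ε)
    (hN : ∀ w : ℂ, R < ‖w‖ → ‖w‖ < 1 →
      nevanlinnaCounting φ w ≤ ENNReal.ofReal (ε * Real.log (1 / ‖w‖) ^ (p + 2)))
    {r ρ δ : ℝ} (hr : r ∈ Set.Ioo (0 : ℝ) 1) (hρ : ρ ∈ Set.Ioo R 1) (hδ0 : 0 < δ) (hδ1 : δ ≤ 1)
    (hδ : closedBall (φ 0) δ ⊆ ball 0 1) {v : ℂ} (hv0 : v ≠ h 0) (hvφ : v ≠ h (φ 0)) :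
    ENNReal.ofReal (jensenDefect (fun z => h (φ z)) 0 r v) ≤
      ENNReal.ofReal ε * (ENNReal.ofReal ((p + 1) * (p + 2)) * ∫⁻ s in Set.Ioi (0 : ℝ),
        ENNReal.ofReal (s ^ p) * ENNReal.ofReal (jensenDefect h 0 (Real.exp (-s)) v)) +
      ENNReal.ofReal (Real.log (4 / δ) / Real.log (ρ / R)) *
        ENNReal.ofReal (jensenDefect h 0 ρ v) +
      ENNReal.ofReal (1 + Real.log (2 / δ) / Real.log 2) *
        ENNReal.ofReal (jensenDefect h (φ 0) δ v) := by
  classical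
  have hρ0 : 0 < ρ := hR.trans hρ.1
  set C₁ := Real.log (4 / δ) / Real.log (ρ / R) with hC₁
  set C₂ := 1 + Real.log (2 / δ) / Real.log 2 with hC₂
  have hlogρ : 0 < Real.log (ρ / R) := Real.log_pos ((one_lt_div hR).2 hρ.1)
  have hC₁0 : 0 ≤ C₁ :=
    div_nonneg (Real.log_nonneg (by rw [le_div_iff₀ hδ0]; linarith)) hlogρ.le
  have hC₂0 : 0 ≤ C₂ := by
    have h2 : 0 < Real.log 2 := Real.log_pos one_lt_two
    have h4 : 0 ≤ Real.log (2 / δ) := Real.log_nonneg (by rw [le_div_iff₀ hδ0]; linarith)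
    positivity
  have hsub : closedBall (0 : ℂ) r ⊆ ball 0 1 := closedBall_subset_ball hr.2
  have hu : AnalyticOnNhd ℂ (fun z => h (φ z)) (closedBall 0 r) :=
    ((hh.comp hφ hmaps).analyticOnNhd isOpen_ball).mono hsub
  have hha : AnalyticOnNhd ℂ h (ball 0 1) := hh.analyticOnNhd isOpen_ball
  obtain ⟨S, hS1, -, hS⟩ := exists_finset_jensenDefect_eq hu hr.1 hvφ
  set m : ℂ → ℕ := fun w => analyticOrderNatAt (fun ζ => h ζ - v) w with hm
  set W := S.image φ with hW
  have hWp : ∀ w ∈ W, w ∈ ball (0 : ℂ) 1 ∧ h w = v := by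
    intro w hw
    obtain ⟨z, hz, rfl⟩ := Finset.mem_image.1 hw
    exact ⟨hmaps (hsub (ball_subset_closedBall (hS1 z hz).1)), (hS1 z hz).2⟩
  have hw0 : ∀ w ∈ W, 0 < ‖w‖ := by
    intro w hw
    rw [norm_pos_iff]
    rintro rfl
    exact hv0 (hWp 0 hw).2.symm
  have hwφ : ∀ w ∈ W, w ≠ φ 0 := by
    rintro w hw rfl
    exact hvφ (hWp _ hw).2.symm
  set N : ℂ → ℝ := fun w => ∑ z ∈ S with φ z = w,
    (analyticOrderNatAt (fun ζ => φ ζ - w) z : ℝ) * Real.log (r / ‖z‖) with hNdef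
  -- Zeros of h ∘ φ - v are grouped by their image w = φ(z), and multiplicities multiply.
  have hJ : jensenDefect (fun z => h (φ z)) 0 r v = ∑ w ∈ W, (m w : ℝ) * N w := by
    rw [hS, ← Finset.sum_fiberwise_of_maps_to (t := W) (g := φ)
      (fun z hz => Finset.mem_image_of_mem φ hz)]
    refine Finset.sum_congr rfl fun w _ => ?_
    rw [hNdef, Finset.mul_sum]
    refine Finset.sum_congr rfl fun z hz => ?_
    obtain ⟨hzS, rfl⟩ := Finset.mem_filter.1 hz
    have hzr := ball_subset_closedBall (hS1 z hzS).1
    rw [(analyticOrderNatAt_comp_sub (hha _ (hmaps (hsub hzr)))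
      (hφ.analyticAt (isOpen_ball.mem_nhds (hsub hzr))) (hS1 z hzS).2
      (analyticOrderAt_sub_ne_top hu hr.1 hvφ hzr)).1]
    push_cast
    rw [sub_zero, mul_assoc]
  have hSw : ∀ w, ∀ z ∈ S.filter (φ · = w), z ∈ ball (0 : ℂ) r ∧ φ z = w := fun w z hz =>
    ⟨(hS1 z (Finset.mem_filter.1 hz).1).1, (Finset.mem_filter.1 hz).2⟩
  have ht : ∀ w ∈ W, 0 ≤ Real.log (1 / ‖w‖) := by
    intro w hw
    refine Real.log_nonneg ?_
    rw [one_le_div (hw0 w hw)]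
    exact (mem_ball_zero_iff.1 (hWp w hw).1).le
  have hN1 : ∀ w ∈ W, R < ‖w‖ → N w ≤ ε * Real.log (1 / ‖w‖) ^ (p + 2) := by
    intro w hw hRw
    refine (ENNReal.ofReal_le_ofReal_iff (mul_nonneg hε (pow_nonneg (ht w hw) _))).1 ?_
    exact (ofReal_sum_le_nevanlinnaCounting (hwφ w hw) hr _ (hSw w)).trans
      (hN w hRw (mem_ball_zero_iff.1 (hWp w hw).1))
  have hN2 : ∀ w ∈ W, N w ≤ Real.log (2 / ‖w - φ 0‖) := by
    intro w hw
    have h1 := sum_mul_log_le_jensenDefect ((hφ.analyticOnNhd isOpen_ball).mono hsub) hr.1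
      (hwφ w hw) (S.filter (φ · = w)) (fun z => analyticOrderNatAt (fun ζ => φ ζ - w) z)
      (fun z hz => (hSw w z hz).1) (fun z _ => le_rfl)
    simp only [sub_zero] at h1
    exact h1.trans (jensenDefect_le_log hφ hmaps hr (hWp w hw).1 (hwφ w hw))
  -- Three regimes: for |w| > R the hypothesis applies; within δ/2 of φ(0) the pole is absorbed by
  -- the last term; otherwise the universal bound is at most log(4/δ), while |w| ≤ R < ρ gives
  -- log(ρ/|w|) ≥ log(ρ/R).
  have hNle : ∀ w ∈ W, N w ≤ ε * Real.log (1 / ‖w‖) ^ (p + 2) +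
      C₁ * (if w ∈ ball (0 : ℂ) ρ then Real.log (ρ / ‖w - 0‖) else 0) +
      C₂ * (if w ∈ ball (φ 0) δ then Real.log (δ / ‖w - φ 0‖) else 0) := by
    intro w hw
    have hx : 0 < ‖w - φ 0‖ := norm_pos_iff.2 (sub_ne_zero.2 (hwφ w hw))
    have ha : 0 ≤ ε * Real.log (1 / ‖w‖) ^ (p + 2) := mul_nonneg hε (pow_nonneg (ht w hw) _)
    have hb : 0 ≤ if w ∈ ball (0 : ℂ) ρ then Real.log (ρ / ‖w - 0‖) else 0 := by
      split_ifs with h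
      · rw [sub_zero]
        exact Real.log_nonneg ((one_le_div (hw0 w hw)).2 (mem_ball_zero_iff.1 h).le)
      · exact le_rfl
    have hc : 0 ≤ if w ∈ ball (φ 0) δ then Real.log (δ / ‖w - φ 0‖) else 0 := by
      split_ifs with h
      · exact Real.log_nonneg ((one_le_div hx).2 (mem_ball_iff_norm.1 h).le)
      · exact le_rfl
    have hb' := mul_nonneg hC₁0 hb
    have hc' := mul_nonneg hC₂0 hc
    rcases lt_or_ge R ‖w‖ with hRw | hRw
    · linarith [hN1 w hw hRw]
    rcases le_or_gt ‖w - φ 0‖ (δ / 2) with hxδ | hxδ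
    · have hmem : w ∈ ball (φ 0) δ := mem_ball_iff_norm.2 (by linarith)
      rw [if_pos hmem]
      linarith [hN2 w hw, log_two_div_le hx hδ0 hδ1 hxδ]
    · have hmem : w ∈ ball (0 : ℂ) ρ := mem_ball_zero_iff.2 (hRw.trans_lt hρ.1)
      have h1 : Real.log (2 / ‖w - φ 0‖) ≤ Real.log (4 / δ) := by
        refine Real.log_le_log (by positivity) ?_
        rw [div_le_div_iff₀ hx hδ0]; linarith
      have h2 : Real.log (4 / δ) ≤ C₁ * Real.log (ρ / ‖w - 0‖) := by
        rw [sub_zero]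
        calc Real.log (4 / δ) = C₁ * Real.log (ρ / R) := by rw [hC₁]; field_simp
          _ ≤ C₁ * Real.log (ρ / ‖w‖) := by
            have := hw0 w hw
            gcongr
      rw [if_pos hmem]
      linarith [hN2 w hw]
  have hfilter : ∀ (c : ℂ) (d : ℝ), 0 < d → closedBall c d ⊆ ball 0 1 → v ≠ h c →
      ∑ w ∈ W, (m w : ℝ) * (if w ∈ ball c d then Real.log (d / ‖w - c‖) else 0) ≤
        jensenDefect h c d v := by
    intro c d hd hcd hvc
    have h1 := sum_mul_log_le_jensenDefect (hha.mono hcd) hd hvc (W.filter (· ∈ ball c d)) m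
      (fun z hz => (Finset.mem_filter.1 hz).2) (fun z _ => le_rfl)
    rw [Finset.sum_filter] at h1
    simpa only [mul_ite, mul_zero] using h1
  have hρsub : closedBall (0 : ℂ) ρ ⊆ ball 0 1 := closedBall_subset_ball hρ.2
  have hreal : jensenDefect (fun z => h (φ z)) 0 r v ≤
      ε * ∑ w ∈ W, (m w : ℝ) * Real.log (1 / ‖w‖) ^ (p + 2) +
      C₁ * jensenDefect h 0 ρ v + C₂ * jensenDefect h (φ 0) δ v := by
    rw [hJ]
    calc ∑ w ∈ W, (m w : ℝ) * N w
        ≤ ∑ w ∈ W, (m w : ℝ) * (ε * Real.log (1 / ‖w‖) ^ (p + 2) +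
          C₁ * (if w ∈ ball (0 : ℂ) ρ then Real.log (ρ / ‖w - 0‖) else 0) +
          C₂ * (if w ∈ ball (φ 0) δ then Real.log (δ / ‖w - φ 0‖) else 0)) :=
          Finset.sum_le_sum fun w hw =>
            mul_le_mul_of_nonneg_left (hNle w hw) (Nat.cast_nonneg _)
      _ = ε * ∑ w ∈ W, (m w : ℝ) * Real.log (1 / ‖w‖) ^ (p + 2) +
          C₁ * ∑ w ∈ W, (m w : ℝ) * (if w ∈ ball (0 : ℂ) ρ then Real.log (ρ / ‖w - 0‖) else 0) +
          C₂ * ∑ w ∈ W, (m w : ℝ) *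
            (if w ∈ ball (φ 0) δ then Real.log (δ / ‖w - φ 0‖) else 0) := by
          rw [Finset.mul_sum, Finset.mul_sum, Finset.mul_sum, ← Finset.sum_add_distrib,
            ← Finset.sum_add_distrib]
          exact Finset.sum_congr rfl fun w _ => by ring
      _ ≤ _ := by
          gcongr
          · exact hfilter 0 ρ hρ0 hρsub hv0
          · exact hfilter (φ 0) δ hδ0 hδ hvφ
  have hJ1 := jensenDefect_nonneg (hha.mono hρsub) hρ0 hv0
  have hJ2 := jensenDefect_nonneg (hha.mono hδ) hδ0 hvφ
  have hsum0 : 0 ≤ ∑ w ∈ W, (m w : ℝ) * Real.log (1 / ‖w‖) ^ (p + 2) :=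
    Finset.sum_nonneg fun w hw => mul_nonneg (Nat.cast_nonneg _) (pow_nonneg (ht w hw) _)
  refine (ENNReal.ofReal_le_ofReal hreal).trans ?_
  rw [ENNReal.ofReal_add (by positivity) (by positivity),
    ENNReal.ofReal_add (by positivity) (by positivity), ENNReal.ofReal_mul hε,
    ENNReal.ofReal_mul hC₁0, ENNReal.ofReal_mul hC₂0]
  gcongr
  exact ofReal_sum_mul_log_pow_le hh hv0 p W hWp

namespace HardySpace

/-- The exponents match: n differentiations cost k^(2n) in the squared coefficients, and the Gamma
integral gains k^(-(p+1)) with p + 1 = 2n. This balance fixes the exponent p + 2 = 2n + 1 of the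
logarithm. -/
theorem tsum_taylorCoeff_iteratedDeriv_le (f : HardySpace) {n p : ℕ} (hp : p + 1 = 2 * n) :
    ∑' k : ℕ, ENNReal.ofReal (‖taylorCoeff (iteratedDeriv n f) (k + 1)‖ ^ 2 *
      (p.factorial / (2 * (k + 1)) ^ (p + 1))) ≤
    ENNReal.ofReal ((n + 1) ^ (2 * n) * p.factorial * ‖f‖ ^ 2) := by
  set K : ℝ := (n + 1) ^ (2 * n) * p.factorial with hK
  have hK0 : 0 ≤ K := by positivity
  rw [norm_sq_eq_tsum, ← tsum_mul_left, ENNReal.ofReal_tsum_of_nonneg (fun k => by positivity)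
    (f.summable_norm_taylorCoeff_sq.mul_left K)]
  refine le_trans (ENNReal.tsum_le_tsum fun k => ?_) (ENNReal.tsum_comp_le_tsum_of_injective
    (f := fun k : ℕ => k + 1 + n) (fun a b h => by simpa using h) _)
  refine ENNReal.ofReal_le_ofReal ?_
  have h1 := norm_taylorCoeff_iteratedDeriv_le f n (k + 1)
  have h2 : ((k + 1 + n : ℕ) : ℝ) ≤ (n + 1) * (k + 1) := by
    push_cast
    nlinarith [mul_nonneg (Nat.cast_nonneg (α := ℝ) n) (Nat.cast_nonneg (α := ℝ) k)]
  have h3 : ‖taylorCoeff (iteratedDeriv n f) (k + 1)‖ ^ 2 ≤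
      (n + 1) ^ (2 * n) * (2 * (k + 1) : ℝ) ^ (2 * n) * ‖taylorCoeff f (k + 1 + n)‖ ^ 2 := by
    calc ‖taylorCoeff (iteratedDeriv n f) (k + 1)‖ ^ 2
        ≤ (((k + 1 + n : ℕ) : ℝ) ^ n * ‖taylorCoeff f (k + 1 + n)‖) ^ 2 := by gcongr
      _ = ((k + 1 + n : ℕ) : ℝ) ^ (2 * n) * ‖taylorCoeff f (k + 1 + n)‖ ^ 2 := by ring
      _ ≤ ((n + 1) * (2 * (k + 1))) ^ (2 * n) * ‖taylorCoeff f (k + 1 + n)‖ ^ 2 := by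
        gcongr
        refine h2.trans ?_
        gcongr
        linarith [Nat.cast_nonneg (α := ℝ) k]
      _ = _ := by rw [mul_pow]
  rw [hp]
  calc _ ≤ ((n + 1) ^ (2 * n) * (2 * (k + 1) : ℝ) ^ (2 * n) * ‖taylorCoeff f (k + 1 + n)‖ ^ 2) *
        (p.factorial / (2 * (k + 1)) ^ (2 * n)) := by gcongr
    _ = _ := by rw [hK]; field_simp

end HardySpace

theorem circleAverage_norm_sq_le {u : ℂ → ℂ} {c : ℂ} {r B : ℝ}
    (hu : ContinuousOn u (closedBall c r)) (hr : 0 < r) (hB : ∀ z ∈ closedBall c r, ‖u z‖ ^ 2 ≤ B) :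
    Real.circleAverage (fun z => ‖u z‖ ^ 2) c r ≤ B :=
  Real.circleAverage_mono_on_of_le_circle (circleIntegrable_norm_sq hu hr) fun z hz =>
    hB z (sphere_subset_closedBall (by rwa [abs_of_pos hr] at hz))

open HardySpace in
/-- The main estimate for the integral means of `f⁽ⁿ⁾ ∘ φ`. -/
theorem hardyMean_iteratedDeriv_comp_le {φ : ℂ → ℂ} (hφ : DifferentiableOn ℂ φ (ball 0 1))
    (hmaps : Set.MapsTo φ (ball 0 1) (ball 0 1)) {n p : ℕ} (hp : p + 1 = 2 * n)
    {R ε : ℝ} (hR : 0 < R) (hε : 0 ≤ ε)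
    (hN : ∀ w : ℂ, R < ‖w‖ → ‖w‖ < 1 →
      nevanlinnaCounting φ w ≤ ENNReal.ofReal (ε * Real.log (1 / ‖w‖) ^ (p + 2)))
    {r ρ δ : ℝ} (hr : r ∈ Set.Ioo (0 : ℝ) 1) (hρ : ρ ∈ Set.Ioo R 1) (hδ0 : 0 < δ) (hδ1 : δ ≤ 1)
    (hδ : closedBall (φ 0) δ ⊆ ball 0 1) (f : HardySpace) {B : ℝ} (hB0 : 0 ≤ B)
    (hB1 : ∀ z ∈ closedBall (0 : ℂ) ρ, ‖iteratedDeriv n f z‖ ^ 2 ≤ B)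
    (hB2 : ∀ z ∈ closedBall (φ 0) δ, ‖iteratedDeriv n f z‖ ^ 2 ≤ B) :
    hardyMean (fun z => iteratedDeriv n f (φ z)) r ≤
      ε * ((p + 1) * (p + 2) * ((n + 1) ^ (2 * n) * p.factorial * ‖f‖ ^ 2)) +
      (1 + Real.log (4 / δ) / Real.log (ρ / R) + (1 + Real.log (2 / δ) / Real.log 2)) * B := by
  set h := iteratedDeriv n f with hh
  have hhd : DifferentiableOn ℂ h (ball 0 1) :=
    differentiableOn_iteratedDeriv isOpen_ball f.differentiableOn n
  set C₁ := Real.log (4 / δ) / Real.log (ρ / R) with hC₁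
  set C₂ := 1 + Real.log (2 / δ) / Real.log 2 with hC₂
  set K := (n + 1 : ℝ) ^ (2 * n) * p.factorial * ‖f‖ ^ 2 with hK
  have hK0 : 0 ≤ K := by positivity
  have hρ0 : 0 < ρ := hR.trans hρ.1
  have hlogρ : 0 < Real.log (ρ / R) := Real.log_pos ((one_lt_div hR).2 hρ.1)
  have hC₁0 : 0 ≤ C₁ :=
    div_nonneg (Real.log_nonneg (by rw [le_div_iff₀ hδ0]; linarith)) hlogρ.le
  have hC₂0 : 0 ≤ C₂ := by
    have h2 : 0 < Real.log 2 := Real.log_pos one_lt_two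
    have h4 : 0 ≤ Real.log (2 / δ) := Real.log_nonneg (by rw [le_div_iff₀ hδ0]; linarith)
    positivity
  have hsub : closedBall (0 : ℂ) r ⊆ ball 0 1 := closedBall_subset_ball hr.2
  have hρsub : closedBall (0 : ℂ) ρ ⊆ ball 0 1 := closedBall_subset_ball hρ.2
  have hu : AnalyticOnNhd ℂ (fun z => h (φ z)) (closedBall 0 r) :=
    ((hhd.comp hφ hmaps).analyticOnNhd isOpen_ball).mono hsub
  have hha : AnalyticOnNhd ℂ h (ball 0 1) := hhd.analyticOnNhd isOpen_ball
  have hpi : 0 < Real.pi / 2 := by positivity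
  have hE1 : ∫⁻ v, ∫⁻ s in Set.Ioi (0 : ℝ),
      ENNReal.ofReal (s ^ p) * ENNReal.ofReal (jensenDefect h 0 (Real.exp (-s)) v) ≤
      ENNReal.ofReal (Real.pi / 2 * K) := by
    rw [lintegral_lintegral_pow_mul_jensenDefect hhd]
    simp only [ENNReal.ofReal_mul hpi.le, mul_left_comm _ (ENNReal.ofReal (Real.pi / 2))]
    rw [lintegral_const_mul' _ _ ENNReal.ofReal_ne_top, lintegral_pow_mul_hardyMean_sub hhd]
    gcongr
    exact f.tsum_taylorCoeff_iteratedDeriv_le hp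
  have hE : ∀ (c : ℂ) (d : ℝ), 0 < d → closedBall c d ⊆ ball 0 1 →
      (∀ z ∈ closedBall c d, ‖h z‖ ^ 2 ≤ B) →
      ∫⁻ v, ENNReal.ofReal (jensenDefect h c d v) ≤ ENNReal.ofReal (Real.pi / 2 * B) := by
    intro c d hd hcd hB
    rw [lintegral_jensenDefect (hha.mono hcd) hd]
    refine ENNReal.ofReal_le_ofReal (mul_le_mul_of_nonneg_left ?_ hpi.le)
    linarith [circleAverage_norm_sq_le (hha.mono hcd).continuousOn hd hB, sq_nonneg ‖h c‖]
  have hmain : ENNReal.ofReal (Real.pi / 2 *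
      (hardyMean (fun z => h (φ z)) r - ‖h (φ 0)‖ ^ 2)) ≤
      ENNReal.ofReal (Real.pi / 2 * (ε * ((p + 1) * (p + 2) * K) + C₁ * B + C₂ * B)) := by
    have h1 := lintegral_jensenDefect hu hr.1
    rw [hardyMean, ← h1]
    -- The pointwise estimate excludes the two values h(0) and h(φ(0)), which form a null set.
    have hne : ∀ᵐ v : ℂ, v ≠ h 0 ∧ v ≠ h (φ 0) := by
      have : ∀ a : ℂ, ∀ᵐ v : ℂ, v ≠ a := fun a => by simp [ae_iff]
      exact (this _).and (this _)
    refine (lintegral_mono_ae (hne.mono fun v hv => ofReal_jensenDefect_comp_le hφ hmaps hhd hR hε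
      hN hr hρ hδ0 hδ1 hδ hv.1 hv.2)).trans ?_
    have hm1 := (measurable_jensenDefect (hha.mono hρsub).continuousOn hρ0).ennreal_ofReal
    have hm2 := (measurable_jensenDefect (hha.mono hδ).continuousOn hδ0).ennreal_ofReal
    rw [lintegral_add_right _ (hm2.const_mul _), lintegral_add_right _ (hm1.const_mul _),
      lintegral_const_mul' _ _ ENNReal.ofReal_ne_top, lintegral_const_mul' _ _ ENNReal.ofReal_ne_top,
      lintegral_const_mul' _ _ ENNReal.ofReal_ne_top, lintegral_const_mul' _ _ ENNReal.ofReal_ne_top]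
    calc _ ≤ ENNReal.ofReal ε * (ENNReal.ofReal ((p + 1) * (p + 2)) *
            ENNReal.ofReal (Real.pi / 2 * K)) +
          ENNReal.ofReal C₁ * ENNReal.ofReal (Real.pi / 2 * B) +
          ENNReal.ofReal C₂ * ENNReal.ofReal (Real.pi / 2 * B) := by
          gcongr
          · exact hE 0 ρ hρ0 hρsub hB1
          · exact hE (φ 0) δ hδ0 hδ hB2
      _ = _ := by
          rw [← ENNReal.ofReal_mul (by positivity), ← ENNReal.ofReal_mul hε,
            ← ENNReal.ofReal_mul hC₁0, ← ENNReal.ofReal_mul hC₂0,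
            ← ENNReal.ofReal_add (by positivity) (by positivity),
            ← ENNReal.ofReal_add (by positivity) (by positivity)]
          congr 1; ring
  have h2 := le_of_mul_le_mul_left ((ENNReal.ofReal_le_ofReal_iff (by positivity)).1 hmain) hpi
  -- The term |h(φ(0))|² ≤ B accounts for the leading 1 in the constant.
  have h3 := hB2 (φ 0) (mem_closedBall_self hδ0.le)
  linarith

/-! ### Approximation by Taylor truncations -/

namespace HardySpace

/-- Termwise estimation leaves a tail of a convergent series, which tends to 0 as i grows, uniformly
for ‖z‖ ≤ x. -/
theorem norm_iteratedDeriv_le_of_taylorCoeff_eq_zero (f : HardySpace) {n i : ℕ}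
    (hf : ∀ k < i, taylorCoeff f (k + n) = 0) {x : ℝ} (hx1 : x < 1)
    (hs : Summable fun k : ℕ => ((k + n : ℕ) : ℝ) ^ n * x ^ k) {z : ℂ} (hz : ‖z‖ ≤ x) :
    ‖iteratedDeriv n f z‖ ≤ ‖f‖ * ∑' k : ℕ, ((k + i + n : ℕ) : ℝ) ^ n * x ^ (k + i) := by
  have hd : DifferentiableOn ℂ (iteratedDeriv n f) (ball 0 1) :=
    differentiableOn_iteratedDeriv isOpen_ball f.differentiableOn n
  have h1 := (hasSum_nat_add_iff' i).2
    (hasSum_taylorCoeff hd (mem_ball_zero_iff.2 (hz.trans_lt hx1)))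
  have h0 : ∑ k ∈ Finset.range i, taylorCoeff (iteratedDeriv n f) k * z ^ k = 0 := by
    refine Finset.sum_eq_zero fun k hk => ?_
    rw [taylorCoeff_iteratedDeriv, hf _ (Finset.mem_range.1 hk)]
    simp
  rw [h0, sub_zero] at h1
  rw [← h1.tsum_eq]
  have h2 := ((summable_nat_add_iff i).2 hs).hasSum.mul_left ‖f‖
  refine tsum_of_norm_bounded h2 fun k => ?_
  rw [norm_mul, norm_pow]
  calc ‖taylorCoeff (iteratedDeriv n f) (k + i)‖ * ‖z‖ ^ (k + i)
      ≤ (((k + i + n : ℕ) : ℝ) ^ n * ‖f‖) * x ^ (k + i) := by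
        gcongr
        refine (norm_taylorCoeff_iteratedDeriv_le _ _ _).trans ?_
        gcongr
        exact f.norm_taylorCoeff_le _
    _ = _ := by ring

theorem summable_pow_mul_geometric {x : ℝ} (hx0 : 0 < x) (hx1 : x < 1) (n : ℕ) :
    Summable fun k : ℕ => ((k + n : ℕ) : ℝ) ^ n * x ^ k := by
  have h1 : Summable fun k : ℕ => (k : ℝ) ^ n * x ^ k :=
    summable_pow_mul_geometric_of_norm_lt_one n (by rwa [Real.norm_of_nonneg hx0.le])
  have h2 := ((summable_nat_add_iff n).2 h1).mul_right (x ^ n)⁻¹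
  refine h2.congr fun k => ?_
  rw [pow_add]
  field_simp

theorem exists_clm_of_hardyMean_le {φ : ℂ → ℂ} (hφ : DifferentiableOn ℂ φ (ball 0 1))
    (hmaps : Set.MapsTo φ (ball 0 1) (ball 0 1)) {n : ℕ} {C : ℝ} (hC : 0 ≤ C)
    (hb : ∀ f : HardySpace, ∀ r ∈ Set.Ico (0 : ℝ) 1,
      hardyMean (fun z => iteratedDeriv n f (φ z)) r ≤ C * ‖f‖ ^ 2) :
    ∃ T : HardySpace →L[ℂ] HardySpace,
      ∀ f : HardySpace, ∀ z ∈ ball (0 : ℂ) 1, T f z = iteratedDeriv n f (φ z) := by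
  have hd : ∀ f : HardySpace, DifferentiableOn ℂ (fun z => iteratedDeriv n f (φ z)) (ball 0 1) :=
    fun f => (differentiableOn_iteratedDeriv isOpen_ball f.differentiableOn n).comp hφ hmaps
  choose T hT hTn using fun f => exists_of_hardyMean_le (hd f) (hb f)
  have hext : ∀ f g : HardySpace, Set.EqOn f g (ball 0 1) → f = g := fun f g h =>
    ext_taylorCoeff fun k => taylorCoeff_congr h k
  refine ⟨LinearMap.mkContinuous
    { toFun := T
      map_add' := fun f g => hext _ _ fun z hz => ?_
      map_smul' := fun a f => hext _ _ fun z hz => ?_ } (√C) fun f => ?_, fun f z hz => hT f hz⟩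
  · exact (hT _ hz).trans ((iteratedDeriv_add f g (hmaps hz) n).trans
      (congrArg₂ (· + ·) (hT f hz).symm (hT g hz).symm))
  · exact (hT _ hz).trans ((iteratedDeriv_smul a f (φ z) n).trans
      (congrArg (a * ·) (hT f hz).symm))
  · refine (sq_le_sq₀ (norm_nonneg _) (by positivity)).1 ?_
    rw [mul_pow, Real.sq_sqrt hC]
    exact hTn f

/-- The monomials. -/
theorem exists_monomial (j : ℕ) :
    ∃ f : HardySpace, ∀ k, taylorCoeff f k = (Pi.single j 1 : ℕ → ℂ) k := by
  refine exists_taylorCoeff_eq (summable_of_ne_finset_zero (s := {j}) fun k hk => ?_)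
  rw [Pi.single_eq_of_ne (by simpa using hk)]
  simp

/-- The truncation of the Taylor series. -/
theorem exists_truncation (m : ℕ) : ∃ S : HardySpace →L[ℂ] HardySpace, IsCompactOperator S ∧
    ∀ (f : HardySpace) (k : ℕ), taylorCoeff (S f) k = if k < m then taylorCoeff f k else 0 := by
  choose e he using exists_monomial
  refine ⟨∑ j ∈ Finset.range m, (coeffCLM j).smulRight (e j), ?_, fun f k => ?_⟩
  · have hmem : (∑ j ∈ Finset.range m, (coeffCLM j).smulRight (e j)) ∈
        compactOperator (RingHom.id ℂ) HardySpace HardySpace := by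
      refine Submodule.sum_mem _ fun j _ => ?_
      have h1 : IsCompactOperator (ContinuousLinearMap.toSpanSingleton ℂ (e j)) :=
        isCompactOperator_of_locallyCompactSpace_rng _
      exact h1.comp_clm (coeffCLM j)
    exact hmem
  · rw [← coeffCLM_apply, sum_apply, map_sum]
    simp only [ContinuousLinearMap.smulRight_apply, map_smul, coeffCLM_apply, he, smul_eq_mul,
      Pi.single_apply, mul_ite, mul_one, mul_zero]
    rw [Finset.sum_ite_eq]
    simp

theorem norm_sub_le_of_truncation {f g : HardySpace} {m : ℕ}
    (h : ∀ k, taylorCoeff g k = if k < m then taylorCoeff f k else 0) :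
    (∀ k < m, taylorCoeff (f - g : HardySpace) k = 0) ∧ ‖f - g‖ ≤ ‖f‖ := by
  have hsub : ∀ k, taylorCoeff (f - g : HardySpace) k = taylorCoeff f k - taylorCoeff g k :=
    fun k => map_sub (coeffCLM k) f g
  refine ⟨fun k hk => by rw [hsub, h, if_pos hk, sub_self], ?_⟩
  refine (sq_le_sq₀ (norm_nonneg _) (norm_nonneg _)).1 ?_
  rw [norm_sq_eq_tsum, norm_sq_eq_tsum]
  refine (summable_norm_taylorCoeff_sq _).tsum_le_tsum (fun k => ?_) (summable_norm_taylorCoeff_sq _)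
  rw [hsub, h]
  split_ifs <;> simp

end HardySpace

open HardySpace in
theorem isCompactCompDeriv_of_nevanlinnaCounting {φ : ℂ → ℂ}
    (hφ : DifferentiableOn ℂ φ (ball 0 1)) (hmaps : Set.MapsTo φ (ball 0 1) (ball 0 1)) {n : ℕ}
    (hn : 0 < n) (hN : ∀ ε : ℝ, 0 < ε → ∃ R : ℝ, 0 < R ∧ R < 1 ∧ ∀ w : ℂ, R < ‖w‖ → ‖w‖ < 1 →
      nevanlinnaCounting φ w ≤ ENNReal.ofReal (ε * Real.log (1 / ‖w‖) ^ (2 * n + 1))) :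
    IsCompactCompDeriv φ n := by
  obtain ⟨p, hp⟩ : ∃ p, p + 1 = 2 * n := ⟨2 * n - 1, by omega⟩
  set K : ℝ := (p + 1) * (p + 2) * ((n + 1) ^ (2 * n) * p.factorial) with hK
  have hK0 : 0 < K := by positivity
  have hφ0 : ‖φ 0‖ < 1 := mem_ball_zero_iff.1 (hmaps (by simp))
  -- The constant C below depends on ε through R, but for fixed ε it is finite, so η still tends to
  -- 0. Taking i = 0 gives boundedness, and letting i grow gives compactness.
  have key : ∀ ε : ℝ, 0 < ε → ∃ η : ℕ → ℝ, Tendsto η atTop (𝓝 0) ∧ (∀ i, 0 ≤ η i) ∧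
      ∀ (i : ℕ) (f : HardySpace), (∀ k < i, taylorCoeff f (k + n) = 0) →
        ∀ r ∈ Set.Ico (0 : ℝ) 1, hardyMean (fun z => iteratedDeriv n f (φ z)) r ≤
          (ε * K + η i) * ‖f‖ ^ 2 := by
    intro ε hε
    obtain ⟨R, hR0, hR1, hNR⟩ := hN ε hε
    set ρ := (1 + R) / 2 with hρ
    set δ := (1 - ‖φ 0‖) / 2 with hδ
    -- A single radius below 1 whose disk contains both closed disks of the main estimate.
    set x := max ρ ((1 + ‖φ 0‖) / 2) with hx
    have hρ0 : 0 < ρ := by rw [hρ]; linarith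
    have hx0 : 0 < x := lt_max_of_lt_left hρ0
    have hx1 : x < 1 := max_lt (by rw [hρ]; linarith) (by linarith)
    have hδ0 : 0 < δ := by rw [hδ]; linarith
    have hδ1 : δ ≤ 1 := by rw [hδ]; linarith [norm_nonneg (φ 0)]
    have hδx : ∀ z ∈ closedBall (φ 0) δ, ‖z‖ ≤ x := by
      intro z hz
      refine le_trans ?_ (le_max_right _ _)
      have h1 := mem_closedBall_iff_norm.1 hz
      have h2 := norm_add_le (z - φ 0) (φ 0)
      rw [sub_add_cancel] at h2
      rw [hδ] at h1
      linarith
    have hs := summable_pow_mul_geometric hx0 hx1 n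
    set C : ℝ := 1 + Real.log (4 / δ) / Real.log (ρ / R) +
      (1 + Real.log (2 / δ) / Real.log 2) with hC
    have hC0 : 0 ≤ C := by
      have h1 : 0 < Real.log (ρ / R) := Real.log_pos ((one_lt_div hR0).2 (by rw [hρ]; linarith))
      have h2 : 0 < Real.log 2 := Real.log_pos one_lt_two
      have h3 : 0 ≤ Real.log (4 / δ) := Real.log_nonneg (by rw [le_div_iff₀ hδ0]; linarith)
      have h4 : 0 ≤ Real.log (2 / δ) := Real.log_nonneg (by rw [le_div_iff₀ hδ0]; linarith)
      positivity
    set σ : ℕ → ℝ := fun i => ∑' k : ℕ, ((k + i + n : ℕ) : ℝ) ^ n * x ^ (k + i) with hσ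
    refine ⟨fun i => C * σ i ^ 2, ?_, fun i => by positivity, fun i f hf r hr => ?_⟩
    · have h1 : Tendsto σ atTop (𝓝 0) :=
        tendsto_sum_nat_add fun k : ℕ => ((k + n : ℕ) : ℝ) ^ n * x ^ k
      simpa using (h1.pow 2).const_mul C
    · have hB : ∀ z : ℂ, ‖z‖ ≤ x → ‖iteratedDeriv n f z‖ ^ 2 ≤ (‖f‖ * σ i) ^ 2 := fun z hz => by
        gcongr
        exact f.norm_iteratedDeriv_le_of_taylorCoeff_eq_zero hf hx1 hs hz
      have hpos : ∀ r ∈ Set.Ioo (0 : ℝ) 1, hardyMean (fun z => iteratedDeriv n f (φ z)) r ≤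
          (ε * K + C * σ i ^ 2) * ‖f‖ ^ 2 := by
        intro r hr
        have hp2 : 2 * n + 1 = p + 2 := by omega
        refine (hardyMean_iteratedDeriv_comp_le hφ hmaps hp hR0 hε.le (by rwa [hp2] at hNR) hr
          (ρ := ρ) ⟨by rw [hρ]; linarith, by rw [hρ]; linarith⟩ hδ0 hδ1
          (fun z hz => mem_ball_zero_iff.2 ((hδx z hz).trans_lt hx1)) f (sq_nonneg _)
          (fun z hz => hB z ((mem_closedBall_zero_iff.1 hz).trans (le_max_left _ _)))
          (fun z hz => hB z (hδx z hz))).trans_eq ?_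
        rw [hK]; ring
      have hd : DifferentiableOn ℂ (fun z => iteratedDeriv n f (φ z)) (ball 0 1) :=
        (differentiableOn_iteratedDeriv isOpen_ball f.differentiableOn n).comp hφ hmaps
      -- The main estimate needs a positive radius; monotonicity of the means covers r = 0.
      have hr' : (1 + r) / 2 ∈ Set.Ioo (0 : ℝ) 1 := ⟨by linarith [hr.1], by linarith [hr.2]⟩
      exact (hardyMean_monotoneOn hd hr ⟨hr'.1.le, hr'.2⟩ (by linarith [hr.2])).trans (hpos _ hr')
  obtain ⟨T, hT⟩ : ∃ T : HardySpace →L[ℂ] HardySpace,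
      ∀ f : HardySpace, ∀ z ∈ ball (0 : ℂ) 1, T f z = iteratedDeriv n f (φ z) := by
    obtain ⟨η, -, hη0, hη⟩ := key 1 one_pos
    exact exists_clm_of_hardyMean_le hφ hmaps (add_nonneg (by positivity) (hη0 0))
      fun f => hη 0 f (by simp)
  refine ⟨T, hT, ?_⟩
  choose S hSc hS using exists_truncation
  -- Truncating at i + n kills the first i Taylor coefficients of the n-th derivative of the
  -- remainder.
  refine isCompactOperator_of_tendsto (l := atTop) (F := fun i : ℕ => T.comp (S (i + n))) ?_
    (Eventually.of_forall fun i => (hSc _).clm_comp T)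
  rw [tendsto_iff_norm_sub_tendsto_zero, Metric.tendsto_atTop]
  intro e he
  -- With this ε both εK and, eventually, η i are at most e²/8, together (e/2)²; the bound e/2 keeps
  -- the final inequality strict.
  obtain ⟨η, hη, hη0, hkey⟩ := key (e ^ 2 / (8 * K)) (by positivity)
  obtain ⟨i₀, hi₀⟩ := eventually_atTop.1 (hη.eventually_lt_const (show 0 < e ^ 2 / 8 by positivity))
  refine ⟨i₀, fun i hi => ?_⟩
  rw [Real.dist_eq, sub_zero, abs_of_nonneg (norm_nonneg _)]
  refine lt_of_le_of_lt ?_ (half_lt_self he)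
  refine ContinuousLinearMap.opNorm_le_bound _ (by positivity) fun f => ?_
  obtain ⟨hz, hle⟩ := norm_sub_le_of_truncation (hS (i + n) f)
  have h1 : (T.comp (S (i + n)) - T) f = -T (f - S (i + n) f) := by simp
  rw [h1, norm_neg]
  refine (sq_le_sq₀ (norm_nonneg _) (by positivity)).1 ?_
  refine le_of_tendsto (tendsto_hardyMean _) ?_
  filter_upwards [Ico_mem_nhdsLT (zero_lt_one' ℝ)] with r hr
  rw [hardyMean_congr (fun z hz => hT _ z hz) hr]
  refine (hkey i _ (fun k hk => hz _ (by omega)) r hr).trans ?_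
  have h2 : e ^ 2 / (8 * K) * K + η i ≤ (e / 2) ^ 2 := by
    have := hi₀ i hi
    have h3 : e ^ 2 / (8 * K) * K = e ^ 2 / 8 := by field_simp
    rw [h3]; linarith
  rw [mul_pow]
  gcongr

theorem theorem2p2 (φ : ℂ → ℂ) (hφ : DifferentiableOn ℂ φ (Metric.ball 0 1))
    (hmaps : Set.MapsTo φ (Metric.ball 0 1) (Metric.ball 0 1)) (n : ℕ) (hn : 0 < n) :
    IsCompactCompDeriv φ n ↔
      ∀ ε : ℝ, 0 < ε → ∃ R : ℝ, 0 < R ∧ R < 1 ∧ ∀ w : ℂ, R < ‖w‖ → ‖w‖ < 1 →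
        nevanlinnaCounting φ w ≤ ENNReal.ofReal (ε * Real.log (1 / ‖w‖) ^ (2 * n + 1)) :=
  ⟨fun h _ hε => nevanlinnaCounting_isLittleO_of_isCompactCompDeriv hφ hmaps h hε,
    isCompactCompDeriv_of_nevanlinnaCounting hφ hmaps hn⟩
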